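/- For a finite simple graph $G=(V,E)$, a set $S\subseteq V$ is a feedback vertex set (fvs) if $G[V\setminus S]$ is a forest; an fvs is minimal if no proper subset of it is an fvs. Let $\mathrm{mmfvs}(G)$ denote the largest size of a minimal fvs of $G$. Max Min FVS is the problem of finding, given $G$, a minimal fvs of $G$ of size $\mathrm{mmfvs}(G)$. Theorem. There is a polynomial-time approximation algorithm for Max Min FVS with ratio $O(n^{2/3})$. That is, there are a (deterministic) algorithm $A$, a polynomial $p$ and a function $r:\mathbb{N}\to[1,\infty)$ with $r(n)=O(n^{2/3})$ as $n\to\infty$, such that for every $n$ and every simple graph $G$ with vertex set $\{0,\dots,n-1\}$, given by its adjacency matrix, $A$ halts after at most $p(n)$ steps and returns a minimal fvs $S$ of $G$ with $$|S|\ \ge\ \frac{\mathrm{mmfvs}(G)}{r(n)}.$$ Here an algorithm is a program of a random access machine with addition and truncated subtraction on natural numbers, indirect addressing, branches and loops, at unit cost per instruction and per test. -/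

import Mathlib

open Asymptotics Filter

namespace MaxMinFVS

/-! ### Minimal feedback vertex sets -/

/-- `S` is a feedback vertex set of `G`: the subgraph induced by the complement of `S` is a
forest. -/
def IsFVS {V : Type*} (G : SimpleGraph V) (S : Finset V) : Prop :=
  (G.induce {v | v ∉ S}).IsAcyclic

/-- `S` is a feedback vertex set of `G`, and no proper subset of `S` is one. -/
def IsMinimalFVS {V : Type*} (G : SimpleGraph V) (S : Finset V) : Prop :=
  IsFVS G S ∧ ∀ T : Finset V, T ⊂ S → ¬ IsFVS G T

open Classical in
/-- The largest cardinality of a minimal feedback vertex set of `G`. (The set of all vertices is a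
feedback vertex set, so minimal ones exist and the supremum is a maximum.) -/
noncomputable def mmfvs {V : Type*} [Fintype V] (G : SimpleGraph V) : ℕ :=
  (Finset.univ.filter fun S : Finset V => IsMinimalFVS G S).sup Finset.card

/-! ### Random access machines

The machine has registers and memory banks; all registers and memory cells hold natural numbers.
A program mentions finitely many registers and finitely many banks, by fixed numbers, and reaches a
cell of a bank indirectly, through the address in a register. The arithmetic is addition and
truncated subtraction, without multiplication, so that an operation lengthens numbers by at most
one bit and unit cost per instruction defines the usual class of polynomial-time algorithms. -/

/-- A memory state: `reg i` is the content of register `i`, and `mem b a` is the content of the cell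
with address `a` in bank `b`. -/
@[ext]
structure State where
  reg : ℕ → ℕ
  mem : ℕ → ℕ → ℕ

/-- Replace the content of register `i` by `x`. -/
def State.setReg (s : State) (i x : ℕ) : State :=
  { s with reg := Function.update s.reg i x }

/-- Replace the content of the cell with address `a` in bank `b` by `x`. -/
def State.setMem (s : State) (b a x : ℕ) : State :=
  { s with mem := Function.update s.mem b (Function.update (s.mem b) a x) }

/-- Programs. The numbers in an instruction are constants of the program. -/
inductive Prog : Type
  /-- do nothing -/
  | skip : Prog
  /-- `reg i := c` -/
  | const (i c : ℕ) : Prog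
  /-- `reg i := reg j + reg k` -/
  | add (i j k : ℕ) : Prog
  /-- `reg i := reg j - reg k`, and `0` if this is negative -/
  | sub (i j k : ℕ) : Prog
  /-- `reg i := mem b (reg j)` -/
  | load (i b j : ℕ) : Prog
  /-- `mem b (reg j) := reg i` -/
  | store (b j i : ℕ) : Prog
  /-- run `P`, then `Q` -/
  | seq (P Q : Prog) : Prog
  /-- run `P` if `reg i` is nonzero, and `Q` otherwise -/
  | branch (i : ℕ) (P Q : Prog) : Prog
  /-- as long as `reg i` is nonzero, run `P` -/
  | loop (i : ℕ) (P : Prog) : Prog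

/-- `Exec P s s' t`: the program `P`, started in the state `s`, halts in the state `s'` after exactly
`t` steps. Every instruction and every test of a register takes one step. -/
inductive Exec : Prog → State → State → ℕ → Prop
  | skip (s : State) : Exec .skip s s 1
  | const (s : State) (i c : ℕ) : Exec (.const i c) s (s.setReg i c) 1
  | add (s : State) (i j k : ℕ) : Exec (.add i j k) s (s.setReg i (s.reg j + s.reg k)) 1
  | sub (s : State) (i j k : ℕ) : Exec (.sub i j k) s (s.setReg i (s.reg j - s.reg k)) 1
  | load (s : State) (i b j : ℕ) : Exec (.load i b j) s (s.setReg i (s.mem b (s.reg j))) 1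
  | store (s : State) (b j i : ℕ) : Exec (.store b j i) s (s.setMem b (s.reg j) (s.reg i)) 1
  | seq {P Q : Prog} {s s' s'' : State} {t t' : ℕ} :
      Exec P s s' t → Exec Q s' s'' t' → Exec (.seq P Q) s s'' (t + t')
  | branch_pos {i : ℕ} {P Q : Prog} {s s' : State} {t : ℕ} :
      s.reg i ≠ 0 → Exec P s s' t → Exec (.branch i P Q) s s' (t + 1)
  | branch_zero {i : ℕ} {P Q : Prog} {s s' : State} {t : ℕ} :
      s.reg i = 0 → Exec Q s s' t → Exec (.branch i P Q) s s' (t + 1)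
  | loop_zero {i : ℕ} {P : Prog} {s : State} :
      s.reg i = 0 → Exec (.loop i P) s s 1
  | loop_pos {i : ℕ} {P : Prog} {s s' s'' : State} {t t' : ℕ} :
      s.reg i ≠ 0 → Exec P s s' t → Exec (.loop i P) s' s'' t' →
      Exec (.loop i P) s s'' (t + t' + 1)

/-- The machine is deterministic: the final state and the running time are unique. -/
theorem Exec.unique {P : Prog} {s s₁ s₂ : State} {t₁ t₂ : ℕ}
    (h₁ : Exec P s s₁ t₁) (h₂ : Exec P s s₂ t₂) : s₁ = s₂ ∧ t₁ = t₂ := by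
  induction h₁ generalizing s₂ t₂ with
  | skip | const | add | sub | load | store => cases h₂; exact ⟨rfl, rfl⟩
  | seq _ _ ih ih' =>
    cases h₂ with
    | seq a b =>
      obtain ⟨rfl, rfl⟩ := ih a
      obtain ⟨rfl, rfl⟩ := ih' b
      exact ⟨rfl, rfl⟩
  | branch_pos h _ ih =>
    cases h₂ with
    | branch_pos _ a =>
      obtain ⟨rfl, rfl⟩ := ih a
      exact ⟨rfl, rfl⟩
    | branch_zero h' _ => exact absurd h' h
  | branch_zero h _ ih =>
    cases h₂ with
    | branch_zero _ a =>
      obtain ⟨rfl, rfl⟩ := ih a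
      exact ⟨rfl, rfl⟩
    | branch_pos h' _ => exact absurd h h'
  | loop_zero h =>
    cases h₂ with
    | loop_zero _ => exact ⟨rfl, rfl⟩
    | loop_pos h' _ _ => exact absurd h h'
  | loop_pos h _ _ ih ih' =>
    cases h₂ with
    | loop_zero h' => exact absurd h' h
    | loop_pos _ a b =>
      obtain ⟨rfl, rfl⟩ := ih a
      obtain ⟨rfl, rfl⟩ := ih' b
      exact ⟨rfl, rfl⟩

/-! ### Approximation algorithms -/

open Classical in
/-- The input: register `0` holds the number `n` of vertices, bank `0` holds the adjacency matrix,
row by row, and everything else is zero. -/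
noncomputable def inputState {n : ℕ} (G : SimpleGraph (Fin n)) : State where
  reg i := if i = 0 then n else 0
  mem b a := if b = 0 ∧ ∃ i j : Fin n, a = i * n + j ∧ G.Adj i j then 1 else 0

/-- The set of vertices that a final state describes: `v` belongs to it if and only if the cell with
address `v` in bank `1` holds the number `1`. -/
def outputSet (n : ℕ) (s : State) : Finset (Fin n) :=
  Finset.univ.filter fun v => s.mem 1 v = 1

/-- `P` is a polynomial-time approximation algorithm with ratio `r`, which may depend on the number
of vertices: on every graph `G` with `n` vertices it halts within a number of steps that is
polynomial in `n`, with a minimal feedback vertex set of `G` of size at least `mmfvs G / r n`. -/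
def IsPolyTimeApprox (P : Prog) (r : ℕ → ℝ) : Prop :=
  ∃ p : Polynomial ℕ, ∀ (n : ℕ) (G : SimpleGraph (Fin n)), ∃ (s : State) (t : ℕ),
    Exec P (inputState G) s t ∧ t ≤ p.eval n ∧
      IsMinimalFVS G (outputSet n s) ∧ (mmfvs G : ℝ) / r n ≤ ((outputSet n s).card : ℝ)

end MaxMinFVS

namespace MaxMinFVS

/-! ### Forests and sets of minimum degree two -/

section Graph

variable {V : Type*}

/-! For each pair of vertices u, v (possibly equal) the set {u, v} is extended greedily to a maximal
induced forest. Its complement is a minimal fvs avoiding u and v, and the algorithm returns a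
largest of these complements, of size m say. So every pair is avoided by some fvs of size at most m.
The heart of the proof is that every minimal fvs S₀ then has at most 6m³ vertices
(`IsMinimalFVS.card_le`). As k = mmfvs(G) is also at most n, k = k^(1/3) · k^(2/3) ≤ 2m · n^(2/3)
(`div_le_of_le_cube`).

For the cubic bound, fix an fvs S of size at most m. By minimality each a in S₀ has a private set
U_a of minimum degree two that meets S₀ only in a (`IsMinimalFVS.exists_private`). For u in S, let
N(u) consist of the neighbours z of u outside S such that some U_a contains both u and z. In the
forest left by S, the set U_a \ S can violate the degree condition only at members of the sets N(u),
and stripping leaves shows that S₀ \ S is no larger than their union (`IsForest.card_le_card`).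

To bound N(u), take an fvs R of size at most m avoiding u, and W = S ∪ R. The members of N(u)
outside R lie in different components of the complement of W, since these components together with u
still form a forest. Each of these components has an edge to some w ≠ u in W
(`exists_reachable_adj`). Given w, an fvs avoiding both u and w misses at most one of the components
attached to both, as two missed ones would close a cycle through u and w (`card_le_card_add_one`).
Hence |N(u)| ≤ m + 2m(m + 1).

The machine decides acyclicity by deleting vertices of degree at most one for n rounds: the set is a
forest if and only if nothing survives. Forests are therefore treated as 1-degenerate sets
throughout (`isFVS_iff`). -/

open Classical in
/-- The number of neighbours of `x` in `U`. -/
noncomputable def degIn (G : SimpleGraph V) (U : Finset V) (x : V) : ℕ :=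
  (U.filter (G.Adj x)).card

/-- `X` induces a forest, stated as degeneracy: every nonempty subset has a vertex with at most one
neighbour in it. -/
def IsForest (G : SimpleGraph V) (X : Finset V) : Prop :=
  ∀ U ⊆ X, U.Nonempty → ∃ x ∈ U, degIn G U x ≤ 1

/-- The graph on all vertices whose edges are those of `G` with both ends in `X`. -/
def within (G : SimpleGraph V) (X : Finset V) : SimpleGraph V where
  Adj a b := a ∈ X ∧ b ∈ X ∧ G.Adj a b
  symm := ⟨fun _ _ h => ⟨h.2.1, h.1, h.2.2.symm⟩⟩
  loopless := ⟨fun _ h => G.loopless.irrefl _ h.2.2⟩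

theorem degIn_mono {G : SimpleGraph V} {U U' : Finset V} (h : U ⊆ U') (x : V) :
    degIn G U x ≤ degIn G U' x := by
  classical
  exact Finset.card_le_card (Finset.filter_subset_filter _ h)

theorem two_le_degIn_iff {G : SimpleGraph V} {U : Finset V} {x : V} :
    2 ≤ degIn G U x ↔ ∃ a ∈ U, ∃ b ∈ U, a ≠ b ∧ G.Adj x a ∧ G.Adj x b := by
  classical
  rw [degIn, ← Nat.lt_iff_add_one_le, Finset.one_lt_card]
  simp only [Finset.mem_filter]
  grind

theorem degIn_le_one_iff {G : SimpleGraph V} {U : Finset V} {x : V} :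
    degIn G U x ≤ 1 ↔ ∀ a ∈ U, ∀ b ∈ U, G.Adj x a → G.Adj x b → a = b := by
  classical
  rw [degIn, Finset.card_le_one]
  simp only [Finset.mem_filter]
  grind

theorem IsForest.mono {G : SimpleGraph V} {X Y : Finset V} (h : IsForest G Y) (hXY : X ⊆ Y) :
    IsForest G X := fun U hU => h U (hU.trans hXY)

theorem within_mono {G : SimpleGraph V} {X Y : Finset V} (h : X ⊆ Y) : within G X ≤ within G Y :=
  fun _ _ hab => ⟨h hab.1, h hab.2.1, hab.2.2⟩

/-- In an acyclic induced subgraph, every set of at least two vertices has, besides any prescribed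
vertex, another one with at most one neighbour in the set. -/
theorem exists_degIn_le_one_ne {G : SimpleGraph V} {X : Set V} (h : (G.induce X).IsAcyclic)
    {U : Finset V} (hU : ∀ x ∈ U, x ∈ X) (hc : 1 < U.card) (r : V) :
    ∃ x ∈ U, x ≠ r ∧ degIn G U x ≤ 1 := by
  classical
  have hH : (G.induce (U : Set V)).IsAcyclic :=
    h.comap (G := G.induce (U : Set V)) (f := ⟨fun x => ⟨x.1, hU x.1 x.2⟩, fun hab => hab⟩)
      (fun a b hab => Subtype.ext (congrArg (fun z : X => (z : V)) hab))
  have : Nontrivial U := by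
    rw [← Fintype.one_lt_card_iff_nontrivial]; simpa using hc
  -- Extending the forest to a spanning tree of the complete graph on `U` yields two leaves even if
  -- the forest is disconnected; one of them differs from `r`.
  have hcon : (⊤ : SimpleGraph U).Connected := SimpleGraph.connected_top
  obtain ⟨T, hT, -, hTT⟩ := hcon.exists_isTree_le_of_le_of_isAcyclic (H := G.induce (U : Set V)) le_top hH
  obtain ⟨a, b, hab, ha, hb⟩ := hTT.exists_ne_and_degree_eq_one
  have key : ∀ a : U, T.degree a = 1 → degIn G U a ≤ 1 := by
    intro a ha
    rw [degIn_le_one_iff]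
    intro x hx y hy hax hay
    rw [SimpleGraph.degree_eq_one_iff_existsUnique_adj] at ha
    have := ha.unique (y₁ := ⟨x, hx⟩) (y₂ := ⟨y, hy⟩) (hT hax) (hT hay)
    simpa using this
  by_cases har : (a : V) = r
  · exact ⟨b, b.2, fun hbr => hab (Subtype.ext (har.trans hbr.symm)), key b hb⟩
  · exact ⟨a, a.2, har, key a ha⟩

theorem isForest_of_isAcyclic {G : SimpleGraph V} {X : Set V} (h : (G.induce X).IsAcyclic)
    {U : Finset V} (hU : ∀ x ∈ U, x ∈ X) : IsForest G U := by
  intro W hW hne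
  by_cases hc : 1 < W.card
  · obtain ⟨x, hx, -, hd⟩ := exists_degIn_le_one_ne h (fun x hx => hU x (hW hx)) hc hne.choose
    exact ⟨x, hx, hd⟩
  · obtain ⟨x, hx⟩ := hne
    classical
    exact ⟨x, hx, (Finset.card_filter_le _ _).trans (not_lt.mp hc)⟩

/-- Every vertex of a cycle has two neighbours on it, so the support of a cycle would contradict
degeneracy. -/
theorem IsForest.isAcyclic_within {G : SimpleGraph V} {X : Finset V} (h : IsForest G X) :
    (within G X).IsAcyclic := by
  classical
  intro v c hc
  have hadj : ∀ a b, c.toSubgraph.Adj a b → a ∈ X ∧ b ∈ X ∧ G.Adj a b :=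
    fun a b hab => c.toSubgraph.adj_sub hab
  have hdeg : ∀ x ∈ c.support, ∃ a b, a ≠ b ∧ c.toSubgraph.Adj x a ∧ c.toSubgraph.Adj x b := by
    intro x hx
    have h2 := hc.ncard_neighborSet_toSubgraph_eq_two hx
    obtain ⟨a, b, hab, hs⟩ := Set.ncard_eq_two.mp h2
    refine ⟨a, b, hab, ?_, ?_⟩
    · have : a ∈ c.toSubgraph.neighborSet x := by rw [hs]; simp
      exact this
    · have : b ∈ c.toSubgraph.neighborSet x := by rw [hs]; simp
      exact this
  obtain ⟨x, hx, hd⟩ := h c.support.toFinset (fun x hx => by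
      obtain ⟨a, b, -, ha, -⟩ := hdeg x (by simpa using hx)
      exact (hadj x a ha).1) ⟨v, by simp⟩
  obtain ⟨a, b, hab, ha, hb⟩ := hdeg x (by simpa using hx)
  refine hab (degIn_le_one_iff.mp hd a ?_ b ?_ (hadj _ _ ha).2.2 (hadj _ _ hb).2.2)
  · simpa using c.toSubgraph.edge_vert ha.symm
  · simpa using c.toSubgraph.edge_vert hb.symm

variable [DecidableEq V]

theorem isFVS_iff [Fintype V] {G : SimpleGraph V} {S : Finset V} : IsFVS G S ↔ IsForest G Sᶜ := by
  constructor
  · intro h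
    exact isForest_of_isAcyclic h (fun x hx => by simpa using hx)
  · intro h
    let f : G.induce {v | v ∉ S} →g within G Sᶜ :=
      ⟨fun x => x.1, fun {a b} hab => ⟨Finset.mem_compl.mpr a.2, Finset.mem_compl.mpr b.2, hab⟩⟩
    exact h.isAcyclic_within.comap f Subtype.val_injective

theorem IsForest.exists_ne [Fintype V] {G : SimpleGraph V} {X : Finset V} (h : IsForest G X)
    {U : Finset V} (hU : U ⊆ X) (hc : 1 < U.card) (r : V) :
    ∃ x ∈ U, x ≠ r ∧ degIn G U x ≤ 1 := by
  have : IsFVS G Xᶜ := by rw [isFVS_iff, compl_compl]; exact h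
  exact exists_degIn_le_one_ne this (fun x hx => by simpa using hU hx) hc r

/-- Two neighbours of `u` that are connected in a set not containing `u` are equal, if that set
together with `u` lies in a forest. -/
theorem IsForest.eq_of_reachable {G : SimpleGraph V} {X Y : Finset V} (h : IsForest G X) {u a b : V}
    (hYX : Y ⊆ X) (huX : u ∈ X) (huY : u ∉ Y) (ha : a ∈ Y) (hb : b ∈ Y) (hua : G.Adj u a)
    (hub : G.Adj u b) (hr : (within G Y).Reachable a b) : a = b := by
  by_contra hab
  -- The edge from `u` to `b` is a bridge, yet for `a ≠ b` the detour through `a` and then inside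
  -- `Y`, which misses `u`, avoids it.
  have hbr := SimpleGraph.isAcyclic_iff_forall_adj_isBridge.mp h.isAcyclic_within
    (v := u) (w := b) ⟨huX, hYX hb, hub⟩
  rw [SimpleGraph.isBridge_iff] at hbr
  apply hbr
  have h1 : ((within G X).deleteEdges {s(u, b)}).Reachable u a := by
    apply SimpleGraph.Adj.reachable
    rw [SimpleGraph.deleteEdges_adj]
    refine ⟨⟨huX, hYX ha, hua⟩, ?_⟩
    simp only [Set.mem_singleton_iff, Sym2.eq_iff]
    grind
  refine h1.trans (hr.mono ?_)
  intro x y hxy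
  rw [SimpleGraph.deleteEdges_adj]
  refine ⟨within_mono hYX hxy, ?_⟩
  have := hxy.1
  have := hxy.2.1
  simp only [Set.mem_singleton_iff, Sym2.eq_iff]
  grind

end Graph

/-! ### Minimal feedback vertex sets versus feedback vertex sets avoiding two vertices -/

section Bound

variable {V : Type*} [DecidableEq V]

/-- In a forest, if every `a ∈ A` lies in a set that contains no other member of `A` and in which
all vertices outside `Z` have two neighbours, then `Z` has at least as many members as `A`. -/
theorem IsForest.card_le_card {G : SimpleGraph V} (F : Finset V) : IsForest G F → ∀ A Z : Finset V,
    (∀ a ∈ A, ∃ U ⊆ F, a ∈ U ∧ (∀ b ∈ A, b ∈ U → b = a) ∧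
      ∀ x ∈ U, x ∈ Z ∨ 2 ≤ degIn G U x) → A.card ≤ Z.card := by
  induction F using Finset.strongInduction with
  | H F ih =>
  intro hF A Z h
  rcases F.eq_empty_or_nonempty with rfl | hne
  · have : A = ∅ := by
      rw [Finset.eq_empty_iff_forall_notMem]
      intro a ha
      obtain ⟨U, hU, haU, -⟩ := h a ha
      simpa using hU haU
    simp [this]
  obtain ⟨l, hl, hdeg⟩ := hF F subset_rfl hne
  have ih' := ih (F.erase l) (Finset.erase_ssubset hl) (hF.mono (Finset.erase_subset _ _))
  have hnot : ∀ U ⊆ F, ¬ 2 ≤ degIn G U l := fun U hU h2 => by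
    have := degIn_mono (G := G) hU l
    omega
  rw [degIn_le_one_iff] at hdeg
  by_cases hlZ : l ∈ Z
  swap
  -- A leaf outside `Z` has too few neighbours to lie in any of the sets, so deleting it changes
  -- none of them.
  · refine ih' A Z fun a ha => ?_
    obtain ⟨U, hU, haU, hb, hd⟩ := h a ha
    refine ⟨U, fun x hx => Finset.mem_erase.mpr ⟨?_, hU hx⟩, haU, hb, hd⟩
    rintro rfl
    rcases hd x hx with h1 | h1
    · exact hlZ h1
    · exact hnot U hU h1
  have hZc := Finset.card_erase_add_one hlZ
  by_cases hlA : l ∈ A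
  · have hAc := Finset.card_erase_add_one hlA
    have := ih' (A.erase l) (Z.erase l) fun a ha => by
      obtain ⟨hal, haA⟩ := Finset.mem_erase.mp ha
      obtain ⟨U, hU, haU, hb, hd⟩ := h a haA
      have hlU : l ∉ U := fun hlU => hal (hb l hlA hlU).symm
      refine ⟨U, fun x hx => Finset.mem_erase.mpr ⟨fun hxl => hlU (hxl ▸ hx), hU hx⟩, haU,
        fun b hbA => hb b (Finset.mem_of_mem_erase hbA), fun x hx => ?_⟩
      refine (hd x hx).imp_left fun hxZ => Finset.mem_erase.mpr ⟨fun hxl => hlU (hxl ▸ hx), hxZ⟩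
    omega
  -- Deleting `l` lowers the degree only of its neighbour. That is harmless if the neighbour joins
  -- `Z'` or leaves `A`: in the latter case no set of a remaining member contains it.
  have hstep : ∀ (A' Z' : Finset V), A' ⊆ A → Z.erase l ⊆ Z' →
      (∀ p ∈ F, G.Adj l p → p ∈ Z' ∨ (p ∈ A ∧ p ∉ A')) → A'.card ≤ Z'.card := by
    intro A' Z' hA' hZ' hp
    refine ih' A' Z' fun a ha => ?_
    obtain ⟨U, hU, haU, hb, hd⟩ := h a (hA' ha)
    refine ⟨U.erase l, Finset.erase_subset_erase l hU, Finset.mem_erase.mpr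
      ⟨fun hal => hlA (hal ▸ hA' ha), haU⟩,
      fun b hbA hbU => hb b (hA' hbA) (Finset.mem_of_mem_erase hbU), fun x hx => ?_⟩
    obtain ⟨hxl, hxU⟩ := Finset.mem_erase.mp hx
    by_cases hlx : G.Adj l x
    · rcases hp x (hU hxU) hlx with h1 | ⟨h1, h2⟩
      · exact Or.inl h1
      · exact absurd (hb x h1 hxU ▸ ha) h2
    · refine (hd x hxU).imp (fun hxZ => hZ' (Finset.mem_erase.mpr ⟨hxl, hxZ⟩)) fun h2 => ?_
      rw [two_le_degIn_iff] at h2 ⊢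
      obtain ⟨a, ha, b, hb, hab, hxa, hxb⟩ := h2
      exact ⟨a, Finset.mem_erase.mpr ⟨fun e => hlx (e ▸ hxa.symm), ha⟩, b,
        Finset.mem_erase.mpr ⟨fun e => hlx (e ▸ hxb.symm), hb⟩, hab, hxa, hxb⟩
  by_cases hp : ∃ p ∈ F, G.Adj l p
  · obtain ⟨p, hpF, hlp⟩ := hp
    have huniq : ∀ q ∈ F, G.Adj l q → q = p := fun q hq hlq => hdeg q hq p hpF hlq hlp
    by_cases hpA : p ∈ A
    · have hAc := Finset.card_erase_add_one hpA
      have := hstep (A.erase p) (Z.erase l) (Finset.erase_subset _ _) subset_rfl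
        fun q hq hlq => by rw [huniq q hq hlq]; exact Or.inr ⟨hpA, Finset.notMem_erase _ _⟩
      omega
    -- Here `p` takes over the place of `l` in `Z`, so the bound does not grow.
    · have := hstep A (insert p (Z.erase l)) subset_rfl (Finset.subset_insert _ _)
        fun q hq hlq => by rw [huniq q hq hlq]; exact Or.inl (Finset.mem_insert_self _ _)
      have := Finset.card_insert_le p (Z.erase l)
      omega
  · have := hstep A (Z.erase l) subset_rfl subset_rfl fun q hq hlq => absurd ⟨q, hq, hlq⟩ hp
    omega

omit [DecidableEq V] in
-- A walk from `z` never leaves the component of `z`, so only that component has to lie in `Y`.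
theorem reachable_within_of_forall {G : SimpleGraph V} {Q Y : Finset V} {z y : V}
    (hz : z ∈ Y) (h : ∀ x ∈ Q, (within G Q).Reachable z x → x ∈ Y)
    (hr : (within G Q).Reachable z y) : (within G Y).Reachable z y := by
  rw [SimpleGraph.reachable_iff_reflTransGen] at hr
  have key : (within G Q).Reachable z y ∧ y ∈ Y ∧ (within G Y).Reachable z y := by
    induction hr with
    | refl => exact ⟨.rfl, hz, .rfl⟩
    | tail _ hbc ih =>
      have hc := ih.1.trans hbc.reachable
      have hcY := h _ hbc.2.1 hc
      exact ⟨hc, hcY, ih.2.2.trans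
        (SimpleGraph.Adj.reachable (G := within G Y) ⟨ih.2.1, hcY, hbc.2.2⟩)⟩
  exact key.2.2

variable [Fintype V]

/-- Leaving `u` along an edge to `z` inside a set of minimum degree two, one meets a vertex of `W`
other than `u`, if the set formed by `u` and the complement of `W` induces a forest. -/
theorem exists_reachable_adj {G : SimpleGraph V} {R W U : Finset V} (hR : IsForest G Rᶜ)
    (hRW : R ⊆ W) {u z : V} (huR : u ∉ R) (hU : ∀ x ∈ U, 2 ≤ degIn G U x)
    (huU : u ∈ U) (hzU : z ∈ U) (hzW : z ∉ W) (huz : G.Adj u z) :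
    ∃ w ∈ W.erase u, ∃ y ∈ Wᶜ, (within G Wᶜ).Reachable z y ∧ G.Adj y w := by
  classical
  by_contra hcon
  push Not at hcon
  -- With `u` added, this part of the component of `z` lies in the forest `Rᶜ` and so has a vertex
  -- `x ≠ u` of degree at most one. If no edge led to `W.erase u`, both neighbours of `x` in `U`
  -- would stay inside.
  let K := (U \ W).filter fun y => (within G Wᶜ).Reachable z y
  have hzK : z ∈ K := by simp [K, hzU, hzW]
  obtain ⟨x, hx, hxu, hd⟩ := hR.exists_ne (U := insert u K) (by
      intro x hx
      rw [Finset.mem_insert] at hx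
      rw [Finset.mem_compl]
      rcases hx with rfl | hx
      · exact huR
      · simp only [K, Finset.mem_filter, Finset.mem_sdiff] at hx
        exact fun h => hx.1.2 (hRW h)) (by
      rw [Finset.one_lt_card]
      exact ⟨u, by simp, z, by simp [hzK], huz.ne⟩) u
  have hxK : x ∈ K := by simpa [hxu] using hx
  simp only [K, Finset.mem_filter, Finset.mem_sdiff] at hxK
  obtain ⟨⟨hxU, hxW⟩, hxr⟩ := hxK
  have hxWc : x ∈ Wᶜ := by simpa using hxW
  have hnb : ∀ a ∈ U, G.Adj x a → a ∈ insert u K := by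
    intro a ha hxa
    by_cases hau : a = u
    · simp [hau]
    have haW : a ∉ W := fun haW =>
      hcon a (Finset.mem_erase.mpr ⟨hau, haW⟩) x hxWc hxr hxa
    refine Finset.mem_insert_of_mem ?_
    simp only [K, Finset.mem_filter, Finset.mem_sdiff]
    exact ⟨⟨ha, haW⟩, hxr.trans (SimpleGraph.Adj.reachable (G := within G Wᶜ)
      ⟨hxWc, by simpa using haW, hxa⟩)⟩
  obtain ⟨a, ha, b, hb, hab, hxa, hxb⟩ := two_le_degIn_iff.mp (hU x hxU)
  exact hab (degIn_le_one_iff.mp hd a (hnb a ha hxa) b (hnb b hb hxb) hxa hxb)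

/-- If many components of the complement of `W` are attached to both `u` and `w`, then every
feedback vertex set avoiding `u` and `w` is large. -/
theorem card_le_card_add_one {G : SimpleGraph V} {R W Z : Finset V} (hR : IsForest G Rᶜ)
    {u w : V} (huR : u ∉ R) (hwR : w ∉ R) (huw : u ≠ w) (huW : u ∈ W)
    (hZW : ∀ z ∈ Z, z ∉ W) (hZu : ∀ z ∈ Z, G.Adj u z)
    (hZ : ∀ z ∈ Z, ∀ z' ∈ Z, (within G Wᶜ).Reachable z z' → z = z')
    (hw : ∀ z ∈ Z, ∃ y ∈ Wᶜ, (within G Wᶜ).Reachable z y ∧ G.Adj y w) :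
    Z.card ≤ R.card + 1 := by
  classical
  -- Components met by `R` inject into `R`. Any two components not met by `R` are joined through `w`
  -- in a set avoiding `u`, so they contain the same neighbour of `u`.
  let hits : V → Prop := fun z => ∃ r ∈ R, r ∈ Wᶜ ∧ (within G Wᶜ).Reachable z r
  rw [← Finset.card_filter_add_card_filter_not (s := Z) hits]
  refine add_le_add ?_ ?_
  · refine Finset.card_le_card_of_forall_subsingleton
      (fun z r => (within G Wᶜ).Reachable z r) ?_ ?_
    · intro z hz
      obtain ⟨r, hr, -, hzr⟩ := (Finset.mem_filter.mp hz).2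
      exact ⟨r, hr, hzr⟩
    · intro r _ z hz z' hz'
      exact hZ z (Finset.mem_filter.mp hz.1).1 z' (Finset.mem_filter.mp hz'.1).1
        (hz.2.trans hz'.2.symm)
  · rw [Finset.card_le_one]
    have hreach : ∀ z ∈ Z, ¬ hits z → z ∈ insert w (Wᶜ \ R) ∧
        (within G (insert w (Wᶜ \ R))).Reachable z w := by
      intro z hz hn
      obtain ⟨y, hy, hzy, hyw⟩ := hw z hz
      have hmem : ∀ x ∈ Wᶜ, (within G Wᶜ).Reachable z x → x ∈ insert w (Wᶜ \ R) := by
        intro x hx hr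
        refine Finset.mem_insert_of_mem (Finset.mem_sdiff.mpr ⟨hx, fun hxR => hn ⟨x, hxR, hx, hr⟩⟩)
      have hzY := hmem z (by simpa using hZW z hz) .rfl
      refine ⟨hzY, (reachable_within_of_forall hzY hmem hzy).trans
        (SimpleGraph.Adj.reachable (G := within G (insert w (Wᶜ \ R)))
          ⟨hmem y hy hzy, Finset.mem_insert_self _ _, hyw⟩)⟩
    intro z hz z' hz'
    obtain ⟨hz, hn⟩ := Finset.mem_filter.mp hz
    obtain ⟨hz', hn'⟩ := Finset.mem_filter.mp hz'
    refine hR.eq_of_reachable (Y := insert w (Wᶜ \ R)) (u := u) ?_ (by simpa using huR) ?_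
      (hreach z hz hn).1 (hreach z' hz' hn').1 (hZu z hz) (hZu z' hz')
      ((hreach z hz hn).2.trans (hreach z' hz' hn').2.symm)
    · intro x hx
      simp only [Finset.mem_insert, Finset.mem_sdiff, Finset.mem_compl] at hx ⊢
      rcases hx with rfl | hx
      · exact hwR
      · exact hx.2
    · simp [huw, huW]

/-- Putting `a` back destroys the forest, so a nonempty set of minimum degree two appears; it must
contain `a`, since without `a` it would lie in the forest left by `S`. -/
theorem IsMinimalFVS.exists_private {G : SimpleGraph V} {S : Finset V} (hS : IsMinimalFVS G S)
    {a : V} (ha : a ∈ S) :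
    ∃ U : Finset V, a ∈ U ∧ (∀ b ∈ S, b ∈ U → b = a) ∧ ∀ x ∈ U, 2 ≤ degIn G U x := by
  have h := hS.2 _ (Finset.erase_ssubset ha)
  rw [isFVS_iff, IsForest] at h
  push Not at h
  obtain ⟨U, hU, hne, hd⟩ := h
  have huniq : ∀ b ∈ S, b ∈ U → b = a := by
    intro b hb hbU
    by_contra hba
    exact Finset.mem_compl.mp (hU hbU) (Finset.mem_erase.mpr ⟨hba, hb⟩)
  refine ⟨U, ?_, huniq, fun x hx => hd x hx⟩
  by_contra haU
  obtain ⟨x, hx, h1⟩ := isFVS_iff.mp hS.1 U (fun x hx => Finset.mem_compl.mpr fun hxS =>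
    haU (huniq x hxS hx ▸ hx)) hne
  have := hd x hx
  omega

/-- If for any two vertices there is a feedback vertex set of size at most `m` avoiding them, then
every minimal feedback vertex set has size `O(m ^ 3)`. -/
theorem IsMinimalFVS.card_le {G : SimpleGraph V} {S₀ : Finset V} (hS₀ : IsMinimalFVS G S₀) {m : ℕ}
    (h : ∀ u v : V, ∃ S : Finset V, u ∉ S ∧ v ∉ S ∧ IsForest G Sᶜ ∧ S.card ≤ m) :
    S₀.card ≤ 6 * m ^ 3 := by
  classical
  choose R hRu hRv hR hRm using h
  rcases S₀.eq_empty_or_nonempty with rfl | ⟨v₀, -⟩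
  · simp
  obtain ⟨S, hS, hSm⟩ : ∃ S : Finset V, IsForest G Sᶜ ∧ S.card ≤ m :=
    ⟨R v₀ v₀, hR _ _, hRm _ _⟩
  have hpriv : ∀ a, ∃ U : Finset V, a ∈ S₀ →
      a ∈ U ∧ (∀ b ∈ S₀, b ∈ U → b = a) ∧ ∀ x ∈ U, 2 ≤ degIn G U x := by
    intro a
    by_cases ha : a ∈ S₀
    · obtain ⟨U, hU⟩ := hS₀.exists_private ha
      exact ⟨U, fun _ => hU⟩
    · exact ⟨∅, fun h => absurd h ha⟩
  choose U hU using hpriv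
  let N : V → Finset V := fun u =>
    Finset.univ.filter fun z => z ∉ S ∧ G.Adj u z ∧ ∃ a ∈ S₀, u ∈ U a ∧ z ∈ U a
  have hN : ∀ u ∈ S, (N u).card ≤ m + 2 * m * (m + 1) := by
    intro u hu
    let W := S ∪ R u u
    -- Members outside `R u u` are sorted by a vertex `w` of `W` reached from them through the
    -- complement of `W`; there are at most `2 * m` choices of `w`.
    have hsub : N u ⊆ R u u ∪ (W.erase u).biUnion fun w => (N u \ R u u).filter fun z =>
        ∃ y ∈ Wᶜ, (within G Wᶜ).Reachable z y ∧ G.Adj y w := by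
      intro z hz
      by_cases hzR : z ∈ R u u
      · exact Finset.mem_union_left _ hzR
      refine Finset.mem_union_right _ ?_
      obtain ⟨-, hzS, huz, a, ha, hua, hza⟩ := Finset.mem_filter.mp hz
      obtain ⟨w, hw, hy⟩ := exists_reachable_adj (hR u u) (W := W) Finset.subset_union_right
        (hRu u u) (hU a ha).2.2 hua hza (by simp [W, hzS, hzR]) huz
      exact Finset.mem_biUnion.mpr ⟨w, hw, Finset.mem_filter.mpr
        ⟨Finset.mem_sdiff.mpr ⟨hz, hzR⟩, hy⟩⟩
    refine (Finset.card_le_card hsub).trans ((Finset.card_union_le _ _).trans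
      (add_le_add (hRm u u) ?_))
    refine (Finset.card_biUnion_le_card_mul _ _ (m + 1) fun w hw => ?_).trans ?_
    · obtain ⟨hwu, hwW⟩ := Finset.mem_erase.mp hw
      have hN' : ∀ z ∈ (N u \ R u u).filter fun z =>
          ∃ y ∈ Wᶜ, (within G Wᶜ).Reachable z y ∧ G.Adj y w, z ∉ W ∧ G.Adj u z := by
        intro z hz
        simp only [N, Finset.mem_filter, Finset.mem_sdiff, Finset.mem_univ, true_and] at hz
        exact ⟨by simp [W, hz.1.1.1, hz.1.2], hz.1.1.2.1⟩
      refine (card_le_card_add_one (hR u w) (W := W) (hRu u w) (hRv u w) hwu.symm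
        (Finset.mem_union_left _ hu) (fun z hz => (hN' z hz).1) (fun z hz => (hN' z hz).2)
        (fun z hz z' hz' hr => ?_) (fun z hz => (Finset.mem_filter.mp hz).2)).trans
        (Nat.succ_le_succ (hRm u w))
      refine (hR u u).eq_of_reachable (Y := Wᶜ) (u := u) ?_ (by simpa using hRu u u) ?_
        (by simpa using (hN' z hz).1) (by simpa using (hN' z' hz').1) (hN' z hz).2 (hN' z' hz').2 hr
      · exact Finset.compl_subset_compl.mpr Finset.subset_union_right
      · simp [W, hu]
    · refine Nat.mul_le_mul_right _ ((Finset.card_erase_le).trans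
        ((Finset.card_union_le _ _).trans ?_))
      have := hRm u u
      omega
  have hA : (S₀ \ S).card ≤ (S.biUnion N).card := by
    refine hS.card_le_card _ _ _ fun a ha => ?_
    obtain ⟨haS₀, haS⟩ := Finset.mem_sdiff.mp ha
    obtain ⟨haU, hb, hd⟩ := hU a haS₀
    refine ⟨U a \ S, fun x hx => by simpa using (Finset.mem_sdiff.mp hx).2,
      Finset.mem_sdiff.mpr ⟨haU, haS⟩,
      fun b hbA hbU => hb b (Finset.mem_sdiff.mp hbA).1 (Finset.mem_sdiff.mp hbU).1,
      fun x hx => ?_⟩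
    obtain ⟨hxU, hxS⟩ := Finset.mem_sdiff.mp hx
    by_cases hxN : x ∈ S.biUnion N
    · exact Or.inl hxN
    refine Or.inr (two_le_degIn_iff.mpr ?_)
    -- A neighbour `c` in `U a ∩ S` would place `x` in `N c`.
    have hnb : ∀ c ∈ U a, G.Adj x c → c ∈ U a \ S := by
      refine fun c hc hxc => Finset.mem_sdiff.mpr ⟨hc, fun hcS => hxN ?_⟩
      refine Finset.mem_biUnion.mpr ⟨c, hcS, Finset.mem_filter.mpr
        ⟨Finset.mem_univ _, hxS, hxc.symm, a, haS₀, hc, hxU⟩⟩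
    obtain ⟨c, hc, d, hd, hcd, hxc, hxd⟩ := two_le_degIn_iff.mp (hd x hxU)
    exact ⟨c, hnb c hc hxc, d, hnb d hd hxd, hcd, hxc, hxd⟩
  have h1 := Finset.card_biUnion_le_card_mul S N _ hN
  have h2 : S₀.card ≤ S.card + (S₀ \ S).card := by
    rw [add_comm]; exact Finset.card_le_card_sdiff_add_card
  have h3 : S.card * (m + 2 * m * (m + 1)) ≤ m * (m + 2 * m * (m + 1)) :=
    Nat.mul_le_mul_right _ hSm
  rcases Nat.eq_zero_or_pos m with rfl | hm
  · omega
  · have h4 : m ≤ m ^ 3 := Nat.le_self_pow (by norm_num) m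
    have h5 : m ^ 2 ≤ m ^ 3 := Nat.pow_le_pow_right hm (by norm_num)
    have h6 : m * (m + 2 * m * (m + 1)) = 3 * m ^ 2 + 2 * m ^ 3 := by ring
    omega

end Bound

/-! ### Reasoning about programs -/

@[simp] theorem State.setReg_reg (s : State) (i x r : ℕ) :
    (s.setReg i x).reg r = if r = i then x else s.reg r := by
  simp [State.setReg, Function.update_apply]

@[simp] theorem State.setReg_mem (s : State) (i x : ℕ) : (s.setReg i x).mem = s.mem := rfl

@[simp] theorem State.setMem_reg (s : State) (b a x : ℕ) : (s.setMem b a x).reg = s.reg := rfl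

theorem State.setMem_mem (s : State) (b a x c d : ℕ) :
    (s.setMem b a x).mem c d = if c = b ∧ d = a then x else s.mem c d := by
  by_cases h : c = b
  · subst h; simp [State.setMem, Function.update_apply]
  · simp [State.setMem, h]

@[simp] theorem State.setMem_mem_self (s : State) (b a x d : ℕ) :
    (s.setMem b a x).mem b d = if d = a then x else s.mem b d := by
  simp [State.setMem_mem]

/-- `s` and `s'` agree on the registers below `L` and on the banks below `B`. -/
def Agree (L B : ℕ) (s s' : State) : Prop :=
  (∀ r < L, s'.reg r = s.reg r) ∧ ∀ b < B, s'.mem b = s.mem b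

theorem Agree.refl (L B : ℕ) (s : State) : Agree L B s s := ⟨fun _ _ => rfl, fun _ _ => rfl⟩

theorem Agree.trans {L B : ℕ} {s s' s'' : State} (h : Agree L B s s') (h' : Agree L B s' s'') :
    Agree L B s s'' :=
  ⟨fun r hr => (h'.1 r hr).trans (h.1 r hr), fun b hb => (h'.2 b hb).trans (h.2 b hb)⟩

theorem Agree.mono {L B L' B' : ℕ} {s s' : State} (h : Agree L' B' s s') (hL : L ≤ L')
    (hB : B ≤ B') : Agree L B s s' :=
  ⟨fun r hr => h.1 r (hr.trans_le hL), fun b hb => h.2 b (hb.trans_le hB)⟩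

theorem agree_setReg {L B i : ℕ} (h : L ≤ i) (s : State) (x : ℕ) : Agree L B s (s.setReg i x) :=
  ⟨fun r hr => by simp [show r ≠ i by omega], fun _ _ => rfl⟩

theorem agree_setMem {L B b : ℕ} (h : B ≤ b) (s : State) (a x : ℕ) :
    Agree L B s (s.setMem b a x) :=
  ⟨fun _ _ => rfl, fun c hc => by funext d; simp [State.setMem_mem, show c ≠ b by omega]⟩

/-- Started in `s`, the program `P` halts after at most `T` steps in a state that satisfies `Q`,
and it changes neither registers below `L` nor banks below `B`. -/
def Runs (P : Prog) (L B T : ℕ) (s : State) (Q : State → Prop) : Prop :=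
  ∃ s' t, Exec P s s' t ∧ t ≤ T ∧ Agree L B s s' ∧ Q s'

namespace Runs

variable {P P' : Prog} {L B T T' L' B' : ℕ} {s : State} {Q Q' R : State → Prop}

theorem mono (h : Runs P L' B' T' s Q') (hL : L ≤ L') (hB : B ≤ B') (hT : T' ≤ T)
    (hQ : ∀ s', Agree L' B' s s' → Q' s' → Q s') : Runs P L B T s Q := by
  obtain ⟨s', t, he, ht, ha, hq⟩ := h
  exact ⟨s', t, he, ht.trans hT, ha.mono hL hB, hQ s' ha hq⟩

theorem time (h : Runs P L B T' s Q) (hT : T' ≤ T) : Runs P L B T s Q :=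
  h.mono le_rfl le_rfl hT fun _ _ h => h

theorem seq (h : Runs P L B T s R) (h' : ∀ s', Agree L B s s' → R s' → Runs P' L B T' s' Q) :
    Runs (.seq P P') L B (T + T') s Q := by
  obtain ⟨s', t, he, ht, ha, hq⟩ := h
  obtain ⟨s'', t', he', ht', ha', hq'⟩ := h' s' ha hq
  exact ⟨s'', t + t', .seq he he', by omega, ha.trans ha', hq'⟩

theorem skip (h : Q s) : Runs .skip L B 1 s Q := ⟨s, 1, .skip s, le_rfl, .refl _ _ _, h⟩

theorem const {i c : ℕ} (hi : L ≤ i) (h : Q (s.setReg i c)) : Runs (.const i c) L B 1 s Q :=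
  ⟨_, 1, .const s i c, le_rfl, agree_setReg hi _ _, h⟩

theorem add {i j k : ℕ} (hi : L ≤ i) (h : Q (s.setReg i (s.reg j + s.reg k))) :
    Runs (.add i j k) L B 1 s Q :=
  ⟨_, 1, .add s i j k, le_rfl, agree_setReg hi _ _, h⟩

theorem sub {i j k : ℕ} (hi : L ≤ i) (h : Q (s.setReg i (s.reg j - s.reg k))) :
    Runs (.sub i j k) L B 1 s Q :=
  ⟨_, 1, .sub s i j k, le_rfl, agree_setReg hi _ _, h⟩

theorem load {i b j : ℕ} (hi : L ≤ i) (h : Q (s.setReg i (s.mem b (s.reg j)))) :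
    Runs (.load i b j) L B 1 s Q :=
  ⟨_, 1, .load s i b j, le_rfl, agree_setReg hi _ _, h⟩

theorem store {b j i : ℕ} (hb : B ≤ b) (h : Q (s.setMem b (s.reg j) (s.reg i))) :
    Runs (.store b j i) L B 1 s Q :=
  ⟨_, 1, .store s b j i, le_rfl, agree_setMem hb _ _ _, h⟩

theorem const_seq {i c : ℕ} (hi : L ≤ i) (h : Runs P L B T (s.setReg i c) Q) :
    Runs (.seq (.const i c) P) L B (1 + T) s Q :=
  seq (const (Q := fun s' => s' = s.setReg i c) hi rfl) fun _ _ e => e ▸ h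

theorem add_seq {i j k : ℕ} (hi : L ≤ i) (h : Runs P L B T (s.setReg i (s.reg j + s.reg k)) Q) :
    Runs (.seq (.add i j k) P) L B (1 + T) s Q :=
  seq (add (Q := fun s' => s' = s.setReg i (s.reg j + s.reg k)) hi rfl) fun _ _ e => e ▸ h

theorem sub_seq {i j k : ℕ} (hi : L ≤ i) (h : Runs P L B T (s.setReg i (s.reg j - s.reg k)) Q) :
    Runs (.seq (.sub i j k) P) L B (1 + T) s Q :=
  seq (sub (Q := fun s' => s' = s.setReg i (s.reg j - s.reg k)) hi rfl) fun _ _ e => e ▸ h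

theorem load_seq {i b j : ℕ} (hi : L ≤ i) (h : Runs P L B T (s.setReg i (s.mem b (s.reg j))) Q) :
    Runs (.seq (.load i b j) P) L B (1 + T) s Q :=
  seq (load (Q := fun s' => s' = s.setReg i (s.mem b (s.reg j))) hi rfl) fun _ _ e => e ▸ h

theorem store_seq {b j i : ℕ} (hb : B ≤ b) (h : Runs P L B T (s.setMem b (s.reg j) (s.reg i)) Q) :
    Runs (.seq (.store b j i) P) L B (1 + T) s Q :=
  seq (store (Q := fun s' => s' = s.setMem b (s.reg j) (s.reg i)) hb rfl) fun _ _ e => e ▸ h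

theorem branch {i : ℕ} (h : s.reg i ≠ 0 → Runs P L B T s Q) (h' : s.reg i = 0 → Runs P' L B T s Q) :
    Runs (.branch i P P') L B (T + 1) s Q := by
  by_cases hi : s.reg i = 0
  · obtain ⟨s', t, he, ht, ha, hq⟩ := h' hi
    exact ⟨s', t + 1, .branch_zero hi he, by omega, ha, hq⟩
  · obtain ⟨s', t, he, ht, ha, hq⟩ := h hi
    exact ⟨s', t + 1, .branch_pos hi he, by omega, ha, hq⟩

end Runs

/-- Run `P` with register `i` taking the values from `0` to the content of register `0` minus one.
Register `1` has to hold the number `1`; register `i + 1` is used to test the end of the loop. -/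
def forLoop (i : ℕ) (P : Prog) : Prog :=
  .seq (.const i 0) (.seq (.sub (i + 1) 0 i)
    (.loop (i + 1) (.seq P (.seq (.add i i 1) (.sub (i + 1) 0 i)))))

/-- The invariant `I` must tolerate changes of the two loop registers. These lie at or above `L` and
are not protected by `Agree`, so each run of the body has to guarantee that the counter still holds
`j`. An iteration costs `T` plus two updates and a test; the final `3` pays for two initial
instructions and the last test. -/
theorem Runs.forLoop {i : ℕ} {P : Prog} {L B T n : ℕ} {s : State} (I : ℕ → State → Prop)
    (hL : 2 ≤ L) (hi : L ≤ i) (hn : s.reg 0 = n) (h1 : s.reg 1 = 1)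
    (hI : ∀ j s x r, r = i ∨ r = i + 1 → I j s → I j (s.setReg r x)) (h0 : I 0 s)
    (hstep : ∀ j < n, ∀ s', Agree L B s s' → s'.reg i = j → I j s' →
      Runs P L B T s' fun s'' => s''.reg i = j ∧ I (j + 1) s'') :
    Runs (forLoop i P) L B (n * (T + 3) + 3) s (I n) := by
  -- Induction on the number `d` of remaining iterations, which is the content of the test register.
  have key : ∀ d j, j + d = n → ∀ s', Agree L B s s' → s'.reg i = j → s'.reg (i + 1) = d → I j s' →
      Runs (.loop (i + 1) (.seq P (.seq (.add i i 1) (.sub (i + 1) 0 i)))) L B (d * (T + 3) + 1)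
        s' (I n) := by
    intro d
    induction d with
    | zero =>
      intro j hj s' ha hij hd hIj
      obtain rfl : j = n := by omega
      exact ⟨s', 1, .loop_zero hd, by omega, .refl _ _ _, hIj⟩
    | succ d ih =>
      intro j hj s' ha hij hd hIj
      have hbody : Runs (.seq P (.seq (.add i i 1) (.sub (i + 1) 0 i))) L B (T + (1 + 1)) s'
          fun s'' => s''.reg i = j + 1 ∧ s''.reg (i + 1) = d ∧ I (j + 1) s'' := by
        refine (hstep j (by omega) s' ha hij hIj).seq fun s'' ha' h => ?_
        have e0 : s''.reg 0 = n := ((ha.trans ha').1 0 (by omega)).trans hn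
        have e1 : s''.reg 1 = 1 := ((ha.trans ha').1 1 (by omega)).trans h1
        refine .add_seq hi (.sub (by omega) ⟨?_, ?_, ?_⟩)
        · simp [h.1, e1]
        · simp only [State.setReg_reg, if_true, show (0 : ℕ) ≠ i by omega, if_false, h.1, e0, e1]
          omega
        · exact hI _ _ _ _ (Or.inr rfl) (hI _ _ _ _ (Or.inl rfl) h.2)
      obtain ⟨s₁, t₁, he₁, ht₁, ha₁, h₁⟩ := hbody
      obtain ⟨s₂, t₂, he₂, ht₂, ha₂, h₂⟩ := ih (j + 1) (by omega) s₁ (ha.trans ha₁) h₁.1 h₁.2.1 h₁.2.2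
      refine ⟨s₂, t₁ + t₂ + 1, .loop_pos (by omega) he₁ he₂, ?_, ha₁.trans ha₂, h₂⟩
      rw [Nat.succ_mul]
      omega
  refine Runs.time (.const_seq hi (.sub_seq (by omega) (T := n * (T + 3) + 1) ?_)) (by omega)
  obtain ⟨s', t, he, ht, ha, hq⟩ := key n 0 (by omega) ((s.setReg i 0).setReg (i + 1) n)
    ((agree_setReg hi _ _).trans (agree_setReg (by omega) _ _)) (by simp) (by simp)
    (hI _ _ _ _ (Or.inr rfl) (hI _ _ _ _ (Or.inl rfl) h0))
  have e : (s.setReg i 0).reg 0 - (s.setReg i 0).reg i = n := by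
    simp [show (0 : ℕ) ≠ i by omega, hn]
  rw [e]
  exact ⟨s', t, he, ht, ha, hq⟩

/-! ### The algorithm -/

/-- Put the number of neighbours of `reg 14` in the set in bank `3` into register `17`; register
`13` holds the address of the first entry of the row of `reg 14`. -/
def countNbrs : Prog :=
  .seq (.const 17 0) (forLoop 18 (.seq (.load 20 3 18) (.branch 20
    (.seq (.add 21 13 18) (.seq (.load 22 0 21) (.add 17 17 22))) .skip)))

/-- Delete the vertex `reg 14` from the set in bank `3` if it has at most one neighbour there. -/
def stripVertex : Prog :=
  .seq (.load 16 3 14) (.branch 16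
    (.seq countNbrs (.seq (.sub 17 17 1) (.branch 17 .skip (.seq (.const 20 0) (.store 3 14 20)))))
    .skip)

/-- Apply `stripVertex` to all vertices. -/
def stripRound : Prog :=
  .seq (.const 13 0) (forLoop 14 (.seq stripVertex (.add 13 13 0)))

/-- Set register `10` to zero if and only if the set in bank `2` induces a forest. -/
def forestTest : Prog :=
  .seq (forLoop 11 (.seq (.load 13 2 11) (.store 3 11 13))) (.seq (forLoop 11 stripRound)
    (.seq (.const 10 0) (forLoop 11 (.seq (.load 13 3 11) (.add 10 10 13)))))

/-- Add the vertex `reg 7` to the set in bank `2` if the result induces a forest. -/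
def addVertex : Prog :=
  .seq (.store 2 7 1) (.seq forestTest
    (.branch 10 (.seq (.const 9 0) (.store 2 7 9)) .skip))

/-- Compute in bank `2` a maximal set containing the vertices `reg 3` and `reg 5` that induces a
forest. -/
def greedy : Prog :=
  .seq (forLoop 7 (.seq (.const 9 0) (.store 2 7 9))) (.seq (.store 2 3 1) (.seq (.store 2 5 1)
    (forLoop 7 addVertex)))

/-- Put the size of the complement of the set in bank `2` into register `7`. -/
def complSize : Prog :=
  .seq (.const 7 0) (forLoop 8 (.seq (.load 10 2 8) (.seq (.sub 10 1 10) (.add 7 7 10))))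

/-- Copy the complement of the set in bank `2` to bank `1` and its size `reg 7` to register `2`,
unless the size is less than before. -/
def record : Prog :=
  .seq (.sub 8 2 7) (.branch 8 .skip (.seq (.const 9 0) (.seq (.add 2 7 9)
    (forLoop 8 (.seq (.load 10 2 8) (.seq (.sub 10 1 10) (.store 1 8 10)))))))

/-- The approximation algorithm: a largest one of the minimal feedback vertex sets that `greedy`
finds for all pairs of vertices. -/
def approx : Prog :=
  .seq (.const 1 1) (forLoop 3 (forLoop 5 (.seq greedy (.seq complSize record))))

/-! ### Correctness and running time of the programs -/

section Spec

variable {n : ℕ} {G : SimpleGraph (Fin n)} {s s' : State}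

/-- Bank `b` holds the characteristic function of `X`. -/
def Holds (s : State) (b : ℕ) (X : Finset (Fin n)) : Prop :=
  ∀ v : Fin n, s.mem b v = if v ∈ X then 1 else 0

open Classical in
/-- Register `0` holds `n`, register `1` holds `1` and bank `0` holds the adjacency matrix. -/
def HasInput (G : SimpleGraph (Fin n)) (s : State) : Prop :=
  s.reg 0 = n ∧ s.reg 1 = 1 ∧ ∀ i j : Fin n, s.mem 0 (i * n + j) = if G.Adj i j then 1 else 0

theorem HasInput.agree (h : HasInput G s) {L B : ℕ} (ha : Agree L B s s') (hL : 2 ≤ L := by omega)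
    (hB : 1 ≤ B := by omega) : HasInput G s' := by
  refine ⟨(ha.1 0 (by omega)).trans h.1, (ha.1 1 (by omega)).trans h.2.1, ?_⟩
  rw [ha.2 0 (by omega)]
  exact h.2.2

theorem Holds.agree {b : ℕ} {X : Finset (Fin n)} (h : Holds s b X) {L B : ℕ} (ha : Agree L B s s')
    (hB : b < B := by omega) : Holds s' b X := by
  unfold Holds; rw [ha.2 b hB]; exact h

/-- The induction step for loops that count the vertices with a given property. -/
theorem card_filter_val_lt_succ (p : Fin n → Prop) [DecidablePred p] {j : ℕ} (hj : j < n) :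
    (Finset.univ.filter fun y : Fin n => y.val < j + 1 ∧ p y).card =
      (Finset.univ.filter fun y : Fin n => y.val < j ∧ p y).card + if p ⟨j, hj⟩ then 1 else 0 := by
  classical
  split_ifs with h
  · have : (Finset.univ.filter fun y : Fin n => y.val < j + 1 ∧ p y) =
        insert ⟨j, hj⟩ (Finset.univ.filter fun y : Fin n => y.val < j ∧ p y) := by
      ext y
      simp only [Finset.mem_filter, Finset.mem_univ, true_and, Finset.mem_insert, Fin.ext_iff]
      constructor
      · rintro ⟨h1, h2⟩
        by_cases hy : y.val = j
        · exact Or.inl hy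
        · exact Or.inr ⟨by omega, h2⟩
      · rintro (h1 | ⟨h1, h2⟩)
        · have : y = ⟨j, hj⟩ := Fin.ext h1
          subst this
          exact ⟨by simp, h⟩
        · exact ⟨by omega, h2⟩
    rw [this, Finset.card_insert_of_notMem (by simp)]
  · rw [add_zero]
    congr 1
    ext y
    simp only [Finset.mem_filter, Finset.mem_univ, true_and]
    constructor
    · rintro ⟨h1, h2⟩
      refine ⟨?_, h2⟩
      by_contra hy
      have : y = ⟨j, hj⟩ := Fin.ext (by simp; omega)
      exact h (this ▸ h2)
    · rintro ⟨h1, h2⟩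
      exact ⟨by omega, h2⟩

theorem filter_val_lt_self (p : Fin n → Prop) [DecidablePred p] :
    (Finset.univ.filter fun y : Fin n => y.val < n ∧ p y) = Finset.univ.filter p := by
  ext y; simp

theorem runs_countNbrs (hs : HasInput G s) {D : Finset (Fin n)} (hD : Holds s 3 D) {x : Fin n}
    (hx : s.reg 13 = x * n) :
    Runs countNbrs 17 4 (8 * n + 4) s fun s' => s'.reg 17 = degIn G D x := by
  classical
  refine Runs.time (.const_seq le_rfl (Runs.mono (Runs.forLoop (L := 17) (B := 4) (T := 5) (n := n)
    (fun j s => s.reg 17 =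
      (Finset.univ.filter fun y : Fin n => y.val < j ∧ (y ∈ D ∧ G.Adj x y)).card)
    (by omega) (by omega) (by simp [hs.1]) (by simp [hs.2.1]) ?_ (by simp) ?_)
    le_rfl le_rfl le_rfl ?_)) (T' := 1 + (n * (5 + 3) + 3)) (by omega)
  · rintro j s y r (rfl | rfl) h <;> simpa using h
  · intro j hj s₁ ha hi hI
    have ha : Agree 17 4 s s₁ := (agree_setReg le_rfl _ _).trans ha
    have hD₁ := hD.agree ha
    have h0 := (hs.agree ha).2.2 x ⟨j, hj⟩
    have h13 : s₁.reg 13 = x * n := (ha.1 13 (by omega)).trans hx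
    refine Runs.time (.load_seq (by omega) (.branch (T := 3) (fun h => ?_) fun h => ?_))
      (T' := 1 + (3 + 1)) (by omega)
    · refine Runs.time (.add_seq (by omega) (.load_seq (by omega) (.add (by omega) ⟨?_, ?_⟩)))
        (T' := 1 + (1 + 1)) (by omega)
      · simp [hi]
      · simp only [State.setReg_reg, hi, if_true] at h
        have hjD : (⟨j, hj⟩ : Fin n) ∈ D := by
          by_contra hn
          exact h ((hD₁ ⟨j, hj⟩).trans (if_neg hn))
        rw [card_filter_val_lt_succ _ hj]
        simp [hi, hI, h13, h0, hjD]
    · refine Runs.time (.skip ⟨?_, ?_⟩) (T' := 1) (by omega)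
      · simp [hi]
      · simp only [State.setReg_reg, hi, if_true] at h
        have hjD : (⟨j, hj⟩ : Fin n) ∉ D := by
          intro hn
          have := (hD₁ ⟨j, hj⟩).trans (if_pos hn)
          simp only at this
          omega
        rw [card_filter_val_lt_succ _ hj]
        simp [hI, hjD]
  · intro s' _ h
    rw [h, filter_val_lt_self, degIn]
    congr 1
    ext y
    simp

theorem Holds.setMem_of_eq {b : ℕ} {X Y : Finset (Fin n)} (h : Holds s b X) (x : Fin n) {a c : ℕ}
    (ha : a = x) (hY : ∀ y ≠ x, (y ∈ Y ↔ y ∈ X)) (hc : c = if x ∈ Y then 1 else 0) :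
    Holds (s.setMem b a c) b Y := by
  intro v
  subst ha
  rw [State.setMem_mem_self]
  by_cases hv : v = x
  · subst hv; simp [hc]
  · simp [hY v hv, h v, Fin.val_inj, hv]

theorem runs_stripVertex (hs : HasInput G s) {D : Finset (Fin n)} (hD : Holds s 3 D) {x : Fin n}
    (hx : s.reg 13 = x * n) (hx' : s.reg 14 = x) :
    Runs stripVertex 16 3 (8 * n + 10) s fun s' =>
      Holds s' 3 (if degIn G D x ≤ 1 then D.erase x else D) := by
  have hDx := hD x
  refine Runs.time (.load_seq (by omega) (.branch (T := 8 * n + 8) (fun h => ?_) fun h => ?_))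
    (T' := 1 + (8 * n + 8 + 1)) (by omega)
  · have ha := agree_setReg (L := 16) (B := 4) le_rfl s (s.mem 3 (s.reg 14))
    have hD' := hD.agree ha
    refine Runs.time (.seq ((runs_countNbrs (hs.agree ha) hD' (x := x) ?_).mono
      (by omega) (by omega) le_rfl fun s' h h' => And.intro h h') fun s₁ ha₁ h₁ =>
      .sub_seq (T := 3) (by omega) (.branch (T := 2) (fun h => ?_) fun h => ?_))
      (T' := 8 * n + 4 + (1 + 3)) (by omega)
    · simp [hx]
    · refine Runs.time (.skip ?_) (T' := 1) (by omega)
      have h1 := ((hs.agree ha).agree h₁.1).2.1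
      simp only [State.setReg_reg, if_true, h₁.2, h1] at h
      -- Truncated subtraction of one leaves a nonzero number exactly when the degree is at least
      -- two.
      rw [if_neg (by omega)]
      have hD₁ := hD'.agree h₁.1
      exact hD₁
    · have h1 := ((hs.agree ha).agree h₁.1).2.1
      simp only [State.setReg_reg, if_true, h₁.2, h1] at h
      refine Runs.time (.const_seq (by omega) (.store le_rfl ?_)) (T' := 1 + 1) (by omega)
      rw [if_pos (by omega)]
      have hD₁ := hD'.agree h₁.1
      refine Holds.setMem_of_eq (X := D) hD₁ x ?_ (by simp +contextual) (by simp)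
      simp [h₁.1.1 14 (by omega), hx']
  · refine Runs.time (.skip ?_) (T' := 1) (by omega)
    have hxD : x ∉ D := by
      intro hn
      simp [hx', hDx, hn] at h
    have : (if degIn G D x ≤ 1 then D.erase x else D) = D := by
      rw [Finset.erase_eq_of_notMem hxD]; simp
    rw [this]
    exact hD

/-- `D'` arises from `D` by deleting vertices, none of them in a subset of `D` of minimum degree
two. -/
def KeepsCore (G : SimpleGraph (Fin n)) (D D' : Finset (Fin n)) : Prop :=
  D' ⊆ D ∧ ∀ U ⊆ D, (∀ x ∈ U, 2 ≤ degIn G U x) → U ⊆ D'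

theorem KeepsCore.trans {D D' D'' : Finset (Fin n)} (h : KeepsCore G D D')
    (h' : KeepsCore G D' D'') : KeepsCore G D D'' :=
  ⟨h'.1.trans h.1, fun U hU hd => h'.2 U (h.2 U hU hd) hd⟩

theorem keepsCore_erase {D : Finset (Fin n)} {x : Fin n} :
    KeepsCore G D (if degIn G D x ≤ 1 then D.erase x else D) := by
  split_ifs with h
  · refine ⟨Finset.erase_subset _ _, fun U hU hd y hy => Finset.mem_erase.mpr ⟨?_, hU hy⟩⟩
    rintro rfl
    have := hd y hy
    have := degIn_mono (G := G) hU y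
    omega
  · exact ⟨subset_rfl, fun U hU _ => hU⟩

/-- Each survivor had two neighbours in the current subset of `D` when tested. Measuring its degree
in the initial `D` makes a round without deletions certify minimum degree two. Register `13`
accumulates `j * n` by additions, as the machine cannot multiply. -/
theorem runs_stripRound (hs : HasInput G s) {D : Finset (Fin n)} (hD : Holds s 3 D) :
    Runs stripRound 13 3 (8 * n ^ 2 + 14 * n + 4) s fun s' =>
      ∃ D', Holds s' 3 D' ∧ KeepsCore G D D' ∧ ∀ x ∈ D', 2 ≤ degIn G D x := by
  refine Runs.time (.const_seq le_rfl (Runs.mono (Runs.forLoop (L := 13) (B := 3) (T := 8 * n + 11)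
    (n := n) (fun j s => s.reg 13 = j * n ∧ ∃ D' : Finset (Fin n), Holds s 3 D' ∧
      KeepsCore G D D' ∧ ∀ x ∈ D', x.val < j → 2 ≤ degIn G D x)
    (by omega) (by omega) (by simp [hs.1]) (by simp [hs.2.1]) ?_ ?_ ?_)
    le_rfl le_rfl le_rfl ?_)) (T' := 1 + (n * (8 * n + 11 + 3) + 3)) (by ring_nf; omega)
  · rintro j s y r (rfl | rfl) h <;> exact ⟨by simpa using h.1, h.2⟩
  · exact ⟨by simp, D, hD, ⟨subset_rfl, fun U hU _ => hU⟩, by simp⟩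
  · rintro j hj s₁ ha hi ⟨hI, D', hD', hk, hd⟩
    have ha : Agree 13 3 s s₁ := (agree_setReg le_rfl _ _).trans ha
    have hs₁ := hs.agree ha
    refine Runs.seq (T' := 1) ((runs_stripVertex hs₁ hD' (x := ⟨j, hj⟩) hI hi).mono (by omega)
      (by omega) le_rfl fun s' h h' => And.intro h h') fun s₂ ha₂ h₂ => .add le_rfl ⟨?_, ?_, ?_⟩
    · simp [h₂.1.1 14, hi]
    · simp [h₂.1.1 13, hI, (hs₁.agree h₂.1).1, Nat.succ_mul]
    · refine ⟨_, h₂.2, hk.trans keepsCore_erase, fun x hx hxj => ?_⟩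
      by_cases hxj' : x.val = j
      · obtain rfl : x = ⟨j, hj⟩ := Fin.ext hxj'
        split_ifs at hx with h
        · simp at hx
        · have := degIn_mono (G := G) hk.1 ⟨j, hj⟩
          omega
      · refine hd x ?_ (by omega)
        exact keepsCore_erase.1 hx
  · rintro s' _ ⟨-, D', hD', hk, hd⟩
    exact ⟨D', hD', hk, fun x hx => hd x hx x.2⟩

/-- Stripping ends at the largest subset of minimum degree two, and a nonempty such subset is
exactly an obstruction to degeneracy. -/
theorem isForest_iff_eq_empty {F D : Finset (Fin n)} (h : KeepsCore G F D)
    (hD : ∀ x ∈ D, 2 ≤ degIn G D x) : IsForest G F ↔ D = ∅ := by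
  constructor
  · intro hF
    by_contra hne
    obtain ⟨x, hx, hd⟩ := hF D h.1 (Finset.nonempty_iff_ne_empty.mpr hne)
    have := hD x hx
    omega
  · rintro rfl U hU ⟨x, hx⟩
    by_contra hcon
    push Not at hcon
    simpa using h.2 U hU (fun x hx => hcon x hx) hx

theorem runs_forestTest (hs : HasInput G s) {F : Finset (Fin n)} (hF : Holds s 2 F) :
    Runs forestTest 10 3 (8 * n ^ 3 + 14 * n ^ 2 + 17 * n + 10) s fun s' =>
      (s'.reg 10 = 0 ↔ IsForest G F) := by
  have hcopy : Runs (forLoop 11 (.seq (.load 13 2 11) (.store 3 11 13))) 10 3 (n * (2 + 3) + 3) s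
      fun s' => Holds s' 3 F := by
    refine Runs.mono (Runs.forLoop (L := 10) (B := 3) (T := 2) (n := n)
      (fun j s => ∀ v : Fin n, v.val < j → s.mem 3 v = if v ∈ F then 1 else 0)
      (by omega) (by omega) hs.1 hs.2.1 (fun _ _ _ _ _ h => h) (by simp) ?_)
      le_rfl le_rfl le_rfl fun s' _ h v => h v v.2
    intro j hj s₁ ha hi hI
    refine Runs.time (.load_seq (by omega) (.store le_rfl ⟨by simp [hi], fun v hv => ?_⟩))
      (T' := 1 + 1) le_rfl
    by_cases hvj : v.val = j
    · simp [hi, hvj, ← (hF.agree ha) v]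
    · simp [hi, hvj, hI v (by omega)]
  have hstrip : ∀ s₁, Agree 10 3 s s₁ → Holds s₁ 3 F →
      Runs (forLoop 11 stripRound) 10 3 (n * (8 * n ^ 2 + 14 * n + 4 + 3) + 3) s₁ fun s' =>
        ∃ D, Holds s' 3 D ∧ KeepsCore G F D ∧ ∀ x ∈ D, 2 ≤ degIn G D x := by
    intro s₁ ha hF₁
    have hs₁ := hs.agree ha
    -- Every round deletes a vertex unless minimum degree two has been reached; after `n` rounds the
    -- second alternative forces `D` to be empty.
    refine Runs.mono (Runs.forLoop (L := 10) (B := 3) (T := 8 * n ^ 2 + 14 * n + 4) (n := n)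
      (fun j s => ∃ D : Finset (Fin n), Holds s 3 D ∧ KeepsCore G F D ∧
        ((∀ x ∈ D, 2 ≤ degIn G D x) ∨ D.card + j ≤ n))
      (by omega) (by omega) hs₁.1 hs₁.2.1 (fun _ _ _ _ _ h => h)
      ⟨F, hF₁, ⟨subset_rfl, fun U hU _ => hU⟩, Or.inr (by simpa using F.card_le_univ)⟩ ?_)
      le_rfl le_rfl le_rfl ?_
    · rintro j hj s₂ ha₂ hi ⟨D, hD, hk, hc⟩
      refine (runs_stripRound (hs₁.agree ha₂) hD).mono (by omega) (by omega) le_rfl ?_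
      rintro s₃ ha₃ ⟨D', hD', hk', hd⟩
      refine ⟨by rw [ha₃.1 11 (by omega), hi], D', hD', hk.trans hk', ?_⟩
      by_cases heq : D' = D
      · exact Or.inl (heq ▸ hd)
      · have hlt := Finset.card_lt_card (hk'.1.ssubset_of_ne heq)
        rcases hc with hc | hc
        -- A set of minimum degree two is its own core, so a further round cannot shrink it.
        · exact absurd (hk'.1.antisymm (hk'.2 D subset_rfl hc)) heq
        · exact Or.inr (by omega)
    · rintro s' _ ⟨D, hD, hk, hc⟩
      refine ⟨D, hD, hk, hc.elim id fun hc x hx => ?_⟩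
      have := Finset.card_pos.mpr ⟨x, hx⟩
      omega
  refine Runs.time (hcopy.seq fun s₁ ha₁ h₁ => (hstrip s₁ ha₁ h₁).seq (T' := 1 + (n * (2 + 3) + 3))
    fun s₂ ha₂ h₂ => ?_) (by ring_nf; omega)
  obtain ⟨D, hD, hk, hd⟩ := h₂
  have hs₂ := hs.agree (ha₁.trans ha₂)
  refine .const_seq le_rfl (Runs.mono (Runs.forLoop (L := 10) (B := 4) (T := 2) (n := n)
    (fun j s => s.reg 10 = (Finset.univ.filter fun y : Fin n => y.val < j ∧ y ∈ D).card)
    (by omega) (by omega) (by simp [hs₂.1]) (by simp [hs₂.2.1]) ?_ (by simp) ?_)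
    le_rfl (by omega) le_rfl ?_)
  · rintro j s y r (rfl | rfl) h <;> simpa using h
  · intro j hj s₃ ha₃ hi hI
    have h3 := (hD.agree ((agree_setReg (B := 4) le_rfl _ _).trans ha₃)) ⟨j, hj⟩
    refine Runs.time (.load_seq (by omega) (.add le_rfl ⟨by simp [hi], ?_⟩)) (T' := 1 + 1) le_rfl
    rw [card_filter_val_lt_succ _ hj]
    simp only [State.setReg_reg, hi]
    simp [hI, h3]
  · intro s' _ h
    rw [h, filter_val_lt_self, isForest_iff_eq_empty hk hd]
    simp

open Classical in
theorem runs_addVertex (hs : HasInput G s) {F : Finset (Fin n)} (hF : Holds s 2 F) {x : Fin n}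
    (hx : s.reg 7 = x) :
    Runs addVertex 9 2 (8 * n ^ 3 + 14 * n ^ 2 + 17 * n + 14) s fun s' =>
      Holds s' 2 (if IsForest G (insert x F) then insert x F else F.erase x) := by
  have ha := agree_setMem (L := 9) (B := 2) le_rfl s (s.reg 7) (s.reg 1)
  have hF₁ : Holds (s.setMem 2 (s.reg 7) (s.reg 1)) 2 (insert x F) :=
    hF.setMem_of_eq x hx (by simp +contextual) (by simp [hs.2.1])
  refine Runs.time (.store_seq le_rfl (.seq ((runs_forestTest (hs.agree ha) hF₁).mono (by omega)
    (by omega) le_rfl fun s' h h' => And.intro h h') fun s₁ _ h₁ =>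
    .branch (T := 2) (fun h => ?_) fun h => ?_))
    (T' := 1 + (8 * n ^ 3 + 14 * n ^ 2 + 17 * n + 10 + (2 + 1))) (by omega)
  · rw [Ne, h₁.2] at h
    rw [if_neg h]
    refine Runs.time (.const_seq le_rfl (.store le_rfl ?_)) (T' := 1 + 1) (by omega)
    have := hF₁.agree h₁.1
    refine Holds.setMem_of_eq (X := insert x F) this x ?_ (by simp +contextual) (by simp)
    simp [h₁.1.1 7 (by omega), hx]
  · rw [h₁.2] at h
    rw [if_pos h]
    exact Runs.time (.skip (hF₁.agree h₁.1)) (by omega)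

theorem isForest_pair (u v : Fin n) : IsForest G {u, v} := by
  classical
  rintro U hU ⟨x, hx⟩
  refine ⟨x, hx, degIn_le_one_iff.mpr fun a ha b hb hxa hxb => ?_⟩
  have h1 := hU hx
  have h2 := hU ha
  have h3 := hU hb
  have := hxa.ne
  have := hxb.ne
  simp only [Finset.mem_insert, Finset.mem_singleton] at h1 h2 h3
  grind

theorem runs_greedy (hs : HasInput G s) {u v : Fin n} (hu : s.reg 3 = u) (hv : s.reg 5 = v) :
    Runs greedy 7 2 (8 * n ^ 4 + 14 * n ^ 3 + 17 * n ^ 2 + 22 * n + 8) s fun s' =>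
      ∃ F : Finset (Fin n), Holds s' 2 F ∧ u ∈ F ∧ v ∈ F ∧ IsForest G F ∧
        ∀ x ∉ F, ¬ IsForest G (insert x F) := by
  classical
  have hclear : Runs (forLoop 7 (.seq (.const 9 0) (.store 2 7 9))) 7 2 (n * (2 + 3) + 3) s
      fun s' => Holds s' 2 (∅ : Finset (Fin n)) := by
    refine Runs.mono (Runs.forLoop (L := 7) (B := 2) (T := 2) (n := n)
      (fun j s => ∀ v : Fin n, v.val < j → s.mem 2 v = 0)
      (by omega) (by omega) hs.1 hs.2.1 (fun _ _ _ _ _ h => h) (by simp) ?_)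
      le_rfl le_rfl le_rfl fun s' _ h v => by simpa using h v v.2
    intro j hj s₁ ha hi hI
    refine Runs.time (.const_seq (by omega) (.store le_rfl ⟨by simp [hi], fun v hv => ?_⟩))
      (T' := 1 + 1) le_rfl
    by_cases hvj : v.val = j
    · simp [hi, hvj]
    · simp [hi, hvj, hI v (by omega)]
  refine Runs.time (hclear.seq fun s₁ ha₁ h₁ => .store_seq le_rfl (.store_seq le_rfl ?_))
    (T' := n * (2 + 3) + 3 + (1 + (1 + (n * (8 * n ^ 3 + 14 * n ^ 2 + 17 * n + 14 + 3) + 3))))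
    (by ring_nf; omega)
  have ha₂ := agree_setMem (L := 7) (B := 2) le_rfl s₁ (s₁.reg 3) (s₁.reg 1)
  have h₂ : Holds (s₁.setMem 2 (s₁.reg 3) (s₁.reg 1)) 2 ({u} : Finset (Fin n)) :=
    h₁.setMem_of_eq u (by rw [ha₁.1 3 (by omega), hu]) (by simp) (by simp [(hs.agree ha₁).2.1])
  set s₂ := s₁.setMem 2 (s₁.reg 3) (s₁.reg 1)
  have ha₃ := agree_setMem (L := 7) (B := 2) le_rfl s₂ (s₂.reg 5) (s₂.reg 1)
  have h₃ : Holds (s₂.setMem 2 (s₂.reg 5) (s₂.reg 1)) 2 ({u, v} : Finset (Fin n)) :=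
    h₂.setMem_of_eq v (by rw [(ha₁.trans ha₂).1 5 (by omega), hv]) (by simp +contextual)
      (by simp [(hs.agree (ha₁.trans ha₂)).2.1])
  set s₃ := s₂.setMem 2 (s₂.reg 5) (s₂.reg 1)
  have hs₃ := hs.agree (ha₁.trans (ha₂.trans ha₃))
  refine Runs.mono (Runs.forLoop (L := 7) (B := 2) (T := 8 * n ^ 3 + 14 * n ^ 2 + 17 * n + 14)
    (n := n) (fun j s => ∃ F : Finset (Fin n), Holds s 2 F ∧ u ∈ F ∧ v ∈ F ∧ IsForest G F ∧
        ∀ x ∉ F, x.val < j → ¬ IsForest G (insert x F))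
    (by omega) (by omega) hs₃.1 hs₃.2.1 (fun _ _ _ _ _ h => h)
    ⟨{u, v}, h₃, by simp, by simp, isForest_pair u v, by simp⟩ ?_)
    le_rfl le_rfl le_rfl ?_
  · rintro j hj s₄ ha₄ hi ⟨F, hF, huF, hvF, hfor, hmax⟩
    refine (runs_addVertex (hs₃.agree ha₄) hF (x := ⟨j, hj⟩) hi).mono (by omega) le_rfl le_rfl ?_
    intro s₅ ha₅ h₅
    refine ⟨by rw [ha₅.1 7 (by omega), hi], ?_⟩
    split_ifs at h₅ with h
    · refine ⟨_, h₅, by simp [huF], by simp [hvF], h, fun x hx hxj hfx => ?_⟩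
      rw [Finset.mem_insert, not_or] at hx
      have hne : x.val ≠ j := fun e => hx.1 (Fin.ext e)
      -- A vertex rejected earlier stays rejected, since the forest only grows.
      exact hmax x hx.2 (by omega) (hfx.mono (Finset.insert_subset_insert _
        (Finset.subset_insert _ _)))
    -- A vertex already in `F` passes the test, so a failed test never erases `u`, `v` or any other
    -- chosen vertex.
    · have hjF : (⟨j, hj⟩ : Fin n) ∉ F := fun hjF => h (by rwa [Finset.insert_eq_of_mem hjF])
      rw [Finset.erase_eq_of_notMem hjF] at h₅
      refine ⟨F, h₅, huF, hvF, hfor, fun x hx hxj => ?_⟩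
      by_cases hxj' : x.val = j
      · obtain rfl : x = ⟨j, hj⟩ := Fin.ext hxj'
        exact h
      · exact hmax x hx (by omega)
  · rintro s' _ ⟨F, hF, huF, hvF, hfor, hmax⟩
    exact ⟨F, hF, huF, hvF, hfor, fun x hx => hmax x hx x.2⟩

/-- A smaller fvs would omit some `x ∉ F`, and its complement would be a forest containing `insert x
F`. -/
theorem isMinimalFVS_compl {F : Finset (Fin n)} (hF : IsForest G F)
    (hmax : ∀ x ∉ F, ¬ IsForest G (insert x F)) : IsMinimalFVS G Fᶜ := by
  refine ⟨isFVS_iff.mpr (by rwa [compl_compl]), fun T hT hfvs => ?_⟩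
  obtain ⟨x, hx, hxT⟩ := Finset.exists_of_ssubset hT
  refine hmax x (Finset.mem_compl.mp hx) ((isFVS_iff.mp hfvs).mono fun y hy => ?_)
  rw [Finset.mem_compl]
  rcases Finset.mem_insert.mp hy with rfl | hy
  · exact hxT
  · exact fun h => Finset.mem_compl.mp (hT.1 h) hy

theorem runs_complSize (hs : HasInput G s) {F : Finset (Fin n)} (hF : Holds s 2 F) :
    Runs complSize 7 3 (6 * n + 4) s fun s' => s'.reg 7 = Fᶜ.card := by
  refine Runs.time (.const_seq le_rfl (Runs.mono (Runs.forLoop (L := 7) (B := 3) (T := 3) (n := n)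
    (fun j s => s.reg 7 = (Finset.univ.filter fun y : Fin n => y.val < j ∧ y ∈ Fᶜ).card)
    (by omega) (by omega) (by simp [hs.1]) (by simp [hs.2.1]) ?_ (by simp) ?_)
    le_rfl le_rfl le_rfl ?_)) (T' := 1 + (n * (3 + 3) + 3)) (by omega)
  · rintro j s y r (rfl | rfl) h <;> simpa using h
  · intro j hj s₁ ha hi hI
    have ha : Agree 7 3 s s₁ := (agree_setReg le_rfl _ _).trans ha
    have h2 := (hF.agree ha) ⟨j, hj⟩
    have h1 := (hs.agree ha).2.1
    refine Runs.time (.load_seq (by omega) (.sub_seq (by omega) (.add le_rfl ⟨by simp [hi], ?_⟩)))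
      (T' := 1 + (1 + 1)) le_rfl
    rw [card_filter_val_lt_succ _ hj]
    by_cases hjF : (⟨j, hj⟩ : Fin n) ∈ F <;> simp [hI, hi, h1, h2, hjF]
  · intro s' _ h
    rw [h, filter_val_lt_self, Finset.filter_univ_mem]

theorem runs_record (hs : HasInput G s) {F X : Finset (Fin n)} (hF : Holds s 2 F)
    (h7 : s.reg 7 = Fᶜ.card) (hX : Holds s 1 X) (h2 : s.reg 2 = X.card) :
    Runs record 2 1 (6 * n + 7) s fun s' => s'.reg 3 = s.reg 3 ∧ s'.reg 5 = s.reg 5 ∧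
      Holds s' 1 (if X.card ≤ Fᶜ.card then Fᶜ else X) ∧
      s'.reg 2 = (if X.card ≤ Fᶜ.card then Fᶜ else X).card := by
  refine Runs.time (.sub_seq (by omega) (.branch (T := 6 * n + 5) (fun h => ?_) fun h => ?_))
    (T' := 1 + (6 * n + 5 + 1)) (by omega)
  · simp only [State.setReg_reg, if_true, h2, h7] at h
    rw [if_neg (by omega)]
    exact Runs.time (.skip ⟨by simp, by simp, hX, by simpa using h2⟩) (T' := 1) (by omega)
  · simp only [State.setReg_reg, if_true, h2, h7] at h
    rw [if_pos (by omega)]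
    refine Runs.time (.const_seq (by omega) (.add_seq le_rfl ?_))
      (T' := 1 + (1 + (n * (3 + 3) + 3))) (by omega)
    set s₁ := (((s.setReg 8 (s.reg 2 - s.reg 7)).setReg 9 0).setReg 2 _) with hs₁
    have ha₁ : Agree 2 3 s s₁ := ((agree_setReg (by omega) _ _).trans
      (agree_setReg (by omega) _ _)).trans (agree_setReg (by omega) _ _)
    have hs' := hs.agree ha₁
    -- The loop writes to bank `1`, so with `B := 1` bank `2` is not protected either and its
    -- preservation becomes part of the invariant.
    refine Runs.mono (Runs.forLoop (L := 8) (B := 1) (T := 3) (n := n)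
      (fun j s => s.mem 2 = s₁.mem 2 ∧ ∀ v : Fin n, v.val < j → s.mem 1 v = if v ∈ Fᶜ then 1 else 0)
      (by omega) (by omega) hs'.1 hs'.2.1 (fun _ _ _ _ _ h => h) (by simp) ?_)
      (by omega) le_rfl le_rfl ?_
    · rintro j hj s₂ ha₂ hi ⟨hm, hI⟩
      have h1 := (hs'.agree ha₂).2.1
      refine Runs.time (.load_seq (by omega) (.sub_seq (by omega) (.store le_rfl
        ⟨by simp [hi], ?_, fun v hv => ?_⟩))) (T' := 1 + (1 + 1)) le_rfl
      · rw [← hm]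
        funext a
        simp [State.setMem_mem]
      · have hv2 := (hF.agree ha₁) v
        by_cases hvj : v.val = j
        · rw [hvj] at hv2 ⊢
          by_cases hvF : v ∈ F <;> simp [hi, hm, hv2, h1, hvF]
        · simp only [State.setReg_reg, hi]
          simp [hvj, hI v (by omega)]
    · rintro s' ha' ⟨-, h'⟩
      refine ⟨?_, ?_, fun v => h' v v.2, ?_⟩
      · rw [ha'.1 3 (by omega)]; simp [hs₁]
      · rw [ha'.1 5 (by omega)]; simp [hs₁]
      · rw [ha'.1 2 (by omega)]; simp [hs₁, h7]

/-- What is known of the best set `X` found so far: it is a minimal feedback vertex set, or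
nothing but the empty set has been found, and it is at least as large as some feedback vertex set
avoiding `u` and `v`, for all pairs that have been treated. -/
def IsBest (G : SimpleGraph (Fin n)) (s : State) (treated : Fin n → Fin n → Prop) : Prop :=
  ∃ X : Finset (Fin n), Holds s 1 X ∧ s.reg 2 = X.card ∧ (X = ∅ ∨ IsMinimalFVS G X) ∧
    ∀ u v, treated u v → ∃ S : Finset (Fin n), u ∉ S ∧ v ∉ S ∧ IsForest G Sᶜ ∧ S.card ≤ X.card

theorem runs_pair (hs : HasInput G s) {u v : Fin n} (hu : s.reg 3 = u) (hv : s.reg 5 = v)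
    {treated : Fin n → Fin n → Prop} (hb : IsBest G s treated) :
    Runs (.seq greedy (.seq complSize record)) 2 1
      (8 * n ^ 4 + 14 * n ^ 3 + 17 * n ^ 2 + 34 * n + 19) s fun s' =>
      s'.reg 3 = u ∧ s'.reg 5 = v ∧ IsBest G s' fun a b => treated a b ∨ a = u ∧ b = v := by
  obtain ⟨X, hX, h2, hmin, hall⟩ := hb
  refine Runs.time (.seq ((runs_greedy hs hu hv).mono (by omega) (by omega) le_rfl
    fun s' h h' => And.intro h h') fun s₁ _ h₁ => ?_)
    (T' := 8 * n ^ 4 + 14 * n ^ 3 + 17 * n ^ 2 + 22 * n + 8 + (6 * n + 4 + (6 * n + 7))) (by omega)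
  obtain ⟨ha₁, F, hF, huF, hvF, hfor, hmax⟩ := h₁
  have hs₁ := hs.agree ha₁
  refine .seq ((runs_complSize hs₁ hF).mono (by omega) (by omega) le_rfl
    fun s' h h' => And.intro h h') fun s₂ _ h₂ => ?_
  obtain ⟨ha₂, h7⟩ := h₂
  have ha := ha₁.trans (ha₂.mono le_rfl (by omega))
  refine (runs_record (hs₁.agree ha₂) (hF.agree ha₂) h7 (hX.agree ha)
    ((ha.1 2 (by omega)).trans h2)).mono le_rfl le_rfl le_rfl ?_
  rintro s₃ - ⟨h3, h5, hX', h2'⟩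
  refine ⟨by rw [h3, ha.1 3 (by omega), hu], by rw [h5, ha.1 5 (by omega), hv], _, hX', h2', ?_, ?_⟩
  · split_ifs with hle
    · exact Or.inr (isMinimalFVS_compl hfor hmax)
    · exact hmin
  · have hle : X.card ≤ (if X.card ≤ Fᶜ.card then Fᶜ else X).card ∧
        Fᶜ.card ≤ (if X.card ≤ Fᶜ.card then Fᶜ else X).card := by
      split_ifs with h
      · exact ⟨h, le_rfl⟩
      · exact ⟨le_rfl, by omega⟩
    rintro a b (hab | ⟨rfl, rfl⟩)
    · obtain ⟨S, h1, h2, h3, h4⟩ := hall a b hab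
      exact ⟨S, h1, h2, h3, h4.trans hle.1⟩
    · exact ⟨Fᶜ, by simpa using huF, by simpa using hvF, by rwa [compl_compl], hle.2⟩

theorem IsBest.imp {t t' : Fin n → Fin n → Prop} (h : IsBest G s t) (ht : ∀ a b, t' a b → t a b) :
    IsBest G s t' := by
  obtain ⟨X, h1, h2, h3, h4⟩ := h
  exact ⟨X, h1, h2, h3, fun a b hab => h4 a b (ht a b hab)⟩

theorem IsBest.setReg {t : Fin n → Fin n → Prop} (h : IsBest G s t) {r x : ℕ} (hr : r ≠ 2) :
    IsBest G (s.setReg r x) t := by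
  obtain ⟨X, h1, h2, h3, h4⟩ := h
  exact ⟨X, h1, by simpa [hr.symm] using h2, h3, h4⟩

theorem runs_approx (G : SimpleGraph (Fin n)) :
    Runs approx 1 1 (n * (n * (8 * n ^ 4 + 14 * n ^ 3 + 17 * n ^ 2 + 34 * n + 19 + 3) + 3 + 3) + 4)
      (inputState G) fun s' => IsBest G s' fun _ _ => True := by
  classical
  have hs : HasInput G ((inputState G).setReg 1 1) := by
    refine ⟨by simp [inputState], by simp, fun i j => ?_⟩
    simp only [State.setReg_mem, inputState, true_and]
    refine if_congr ⟨?_, fun h => ⟨i, j, rfl, h⟩⟩ rfl rfl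
    -- The address determines row and column, as quotient and remainder modulo `n`.
    rintro ⟨i', j', he, hadj⟩
    have hn : 0 < n := by have := i.2; omega
    have hi : (i : ℕ) = i' := by
      have := congrArg (· / n) he
      simpa [Nat.add_div_of_dvd_right, Nat.mul_div_cancel _ hn, Nat.div_eq_of_lt] using this
    have hj : (j : ℕ) = j' := by
      have := congrArg (· % n) he
      simpa [Nat.mod_eq_of_lt] using this
    rwa [Fin.ext hi, Fin.ext hj]
  refine Runs.time (.const_seq le_rfl (Runs.mono (Runs.forLoop (L := 2) (B := 1) (n := n)
    (T := n * (8 * n ^ 4 + 14 * n ^ 3 + 17 * n ^ 2 + 34 * n + 19 + 3) + 3)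
    (fun j s => IsBest G s fun u _ => u.val < j) le_rfl (by omega) hs.1 hs.2.1 ?_ ?_ ?_)
    (by omega) le_rfl le_rfl fun s' _ h => h.imp fun a _ _ => a.2)) (by omega)
  · rintro j s x r (rfl | rfl) h <;> exact h.setReg (by omega)
  · exact ⟨∅, fun v => by simp [inputState], by simp [inputState], Or.inl rfl, by simp⟩
  · intro j hj s₁ ha₁ hi hI
    have hs₁ := hs.agree ha₁
    refine Runs.mono (Runs.forLoop (L := 2) (B := 1) (n := n)
      (T := 8 * n ^ 4 + 14 * n ^ 3 + 17 * n ^ 2 + 34 * n + 19)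
      (fun k s => s.reg 3 = j ∧ IsBest G s fun u v => u.val < j ∨ u.val = j ∧ v.val < k)
      le_rfl (by omega) hs₁.1 hs₁.2.1 ?_ ⟨hi, hI.imp (by simp)⟩ ?_) le_rfl le_rfl le_rfl ?_
    · rintro k s x r (rfl | rfl) h <;> exact ⟨by simpa using h.1, h.2.setReg (by omega)⟩
    · rintro k hk s₂ ha₂ hi₂ ⟨h3, hI₂⟩
      refine (runs_pair (hs₁.agree ha₂) (u := ⟨j, hj⟩) (v := ⟨k, hk⟩) h3 hi₂ hI₂).mono le_rfl le_rfl
        le_rfl ?_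
      rintro s₃ - ⟨h3', h5', hb⟩
      refine ⟨h5', h3', hb.imp fun a b hab => ?_⟩
      simp only [Fin.ext_iff]
      omega
    · rintro s' - ⟨h3, hb⟩
      refine ⟨h3, hb.imp fun a b hab => ?_⟩
      have := b.2
      omega

end Spec

/-! ### The approximation ratio -/

theorem mmfvs_le {V : Type*} [Fintype V] {G : SimpleGraph V} {k : ℕ}
    (h : ∀ S : Finset V, IsMinimalFVS G S → S.card ≤ k) : mmfvs G ≤ k := by
  classical
  exact Finset.sup_le fun S hS => h S (Finset.mem_filter.mp hS).2

theorem IsBest.isMinimalFVS {n : ℕ} {G : SimpleGraph (Fin n)} {s : State}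
    (h : IsBest G s fun _ _ => True) :
    IsMinimalFVS G (outputSet n s) ∧ mmfvs G ≤ 6 * (outputSet n s).card ^ 3 := by
  obtain ⟨X, hX, -, hmin, hall⟩ := h
  have hout : outputSet n s = X := by
    ext v
    simp [outputSet, hX v]
  have hall' := fun u v => hall u v trivial
  rw [hout]
  refine ⟨hmin.elim ?_ id, mmfvs_le fun S hS => hS.card_le hall'⟩
  -- If the recorded set is empty, any vertex is avoided by an fvs of size zero, so the empty set is
  -- itself an fvs; without vertices there is nothing to check.
  rintro rfl
  refine ⟨isFVS_iff.mpr fun U hU hne => ?_, fun T hT => absurd hT (Finset.not_ssubset_empty T)⟩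
  obtain ⟨S, -, -, hS, hc⟩ := hall' hne.choose hne.choose
  obtain rfl : S = ∅ := by simpa using hc
  exact hS U hU hne

/-- Split `k` as `k ^ (1/3) * k ^ (2/3)`: since `6 ≤ 2 ^ 3`, the first factor is at most `2 * m`,
and the second is at most `n ^ (2/3)`. The summand `1` keeps the ratio at least one, also for `n =
0`. -/
theorem div_le_of_le_cube {n k m : ℕ} (hkn : k ≤ n) (hkm : k ≤ 6 * m ^ 3) :
    (k : ℝ) / (2 * (n : ℝ) ^ (2 / 3 : ℝ) + 1) ≤ m := by
  have hn : (0 : ℝ) ≤ (n : ℝ) ^ (2 / 3 : ℝ) := by positivity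
  rw [div_le_iff₀ (by positivity)]
  have h1 : (k : ℝ) = (k : ℝ) ^ (1 / 3 : ℝ) * (k : ℝ) ^ (2 / 3 : ℝ) := by
    rw [← Real.rpow_add_of_nonneg (by positivity) (by norm_num) (by norm_num)]
    norm_num
  have h2 : (k : ℝ) ^ (1 / 3 : ℝ) ≤ 2 * m := by
    have h3 : (k : ℝ) ≤ (2 * m) ^ 3 := by
      have : (k : ℝ) ≤ 6 * m ^ 3 := by exact_mod_cast hkm
      have : (0 : ℝ) ≤ (m : ℝ) ^ 3 := by positivity
      nlinarith
    calc (k : ℝ) ^ (1 / 3 : ℝ) ≤ ((2 * (m : ℝ)) ^ 3) ^ (1 / 3 : ℝ) :=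
          Real.rpow_le_rpow (by positivity) h3 (by norm_num)
      _ = 2 * m := by
          rw [← Real.rpow_natCast, ← Real.rpow_mul (by positivity)]
          norm_num
  have h4 : (k : ℝ) ^ (2 / 3 : ℝ) ≤ (n : ℝ) ^ (2 / 3 : ℝ) :=
    Real.rpow_le_rpow (by positivity) (by exact_mod_cast hkn) (by norm_num)
  have h5 : (k : ℝ) ^ (1 / 3 : ℝ) * (k : ℝ) ^ (2 / 3 : ℝ) ≤ 2 * m * (n : ℝ) ^ (2 / 3 : ℝ) :=
    mul_le_mul h2 h4 (by positivity) (by positivity)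
  have h6 : (0 : ℝ) ≤ m := by positivity
  linarith

theorem isBigO_ratio :
    (fun n : ℕ => 2 * (n : ℝ) ^ (2 / 3 : ℝ) + 1) =O[atTop] fun n : ℕ => (n : ℝ) ^ (2 / 3 : ℝ) := by
  refine IsBigO.of_bound 3 ?_
  filter_upwards [eventually_ge_atTop 1] with n hn
  have h1 : (1 : ℝ) ≤ (n : ℝ) ^ (2 / 3 : ℝ) :=
    Real.one_le_rpow (by exact_mod_cast hn) (by norm_num)
  rw [Real.norm_of_nonneg (by positivity), Real.norm_of_nonneg (by positivity)]
  linarith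

theorem isPolyTimeApprox_approx :
    IsPolyTimeApprox approx fun n => 2 * (n : ℝ) ^ (2 / 3 : ℝ) + 1 := by
  -- This is the time bound of `runs_approx`, of degree six: about `n ^ 2` pairs, each with a greedy
  -- run of order `n ^ 4`.
  refine ⟨.X * (.X * (8 * .X ^ 4 + 14 * .X ^ 3 + 17 * .X ^ 2 + 34 * .X + 19 + 3) + 3 + 3) + 4,
    fun n G => ?_⟩
  obtain ⟨s, t, he, ht, -, hb⟩ := runs_approx G
  obtain ⟨hmin, hle⟩ := hb.isMinimalFVS
  refine ⟨s, t, he, by simpa using ht, hmin, div_le_of_le_cube ?_ hle⟩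
  exact mmfvs_le fun S _ => by simpa using S.card_le_univ

end MaxMinFVS

theorem theorem3p7 :
    ∃ (P : MaxMinFVS.Prog) (r : ℕ → ℝ),
      (∀ n, 1 ≤ r n) ∧
      r =O[atTop] (fun n : ℕ => (n : ℝ) ^ (2 / 3 : ℝ)) ∧
      MaxMinFVS.IsPolyTimeApprox P r := by
  refine ⟨MaxMinFVS.approx, fun n => 2 * (n : ℝ) ^ (2 / 3 : ℝ) + 1, fun n => ?_,
    MaxMinFVS.isBigO_ratio, MaxMinFVS.isPolyTimeApprox_approx⟩
  have : (0 : ℝ) ≤ (n : ℝ) ^ (2 / 3 : ℝ) := by positivity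
  linarith
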